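/- Let $d$ be the space dimension and let $\varphi:\mathbb R^d\to\mathbb R$ be $K$-Lipschitz and $\lambda$-concave for some $\lambda\ge 0$, i.e. $y\mapsto\varphi(y)-\frac{\lambda}{2}|y|^2$ is concave. For $\varepsilon,t>0$ let $$u^\varepsilon_t(x)=-\varepsilon\log\left(\frac{1}{(2\pi\varepsilon t)^{d/2}}\int_{\mathbb R^d}\exp\left(-\frac{|x-y|^2}{2\varepsilon t}-\frac{\varphi(y)}{\varepsilon}\right)dy\right),$$ and let $X^\varepsilon$ be the flow of $\nabla u^\varepsilon$: for every $y\in\mathbb R^d$, $t\mapsto X^\varepsilon(y,t)$ is continuous on $[0,\infty)$, $X^\varepsilon(y,0)=y$, and $\partial_tX^\varepsilon(y,t)=\nabla u^\varepsilon_t(X^\varepsilon(y,t))$ for $t>0$. Then such flows exist and the limit $X_t(y)=\lim_{\varepsilon\to0^+}X^\varepsilon(y,t)$ exists for all $y\in\mathbb R^d$ and $t\ge0$. For every $t\ge0$ let $\rho_t=(X_t)_\sharp\mathcal L$ be the pushforward of Lebesgue measure $\mathcal L$ on $\mathbb R^d$, and let $$\mathcal S_t=X_t\bigl(\{y\in\mathbb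 R^d:\nabla X_t(y)\text{ exists and is singular}\}\bigr).$$ Then $\mathcal S_t$ has Lebesgue measure zero, and the Lebesgue decomposition $\rho_t=\rho_t^{\rm ac}+\rho_t^{\rm sg}$, with $\rho_t^{\rm ac}\ll\mathcal L$ and $\rho_t^{\rm sg}\perp\mathcal L$, is given by $$\rho_t^{\rm ac}=\rho_t\llcorner(\mathbb R^d\setminus\mathcal S_t),\qquad \rho_t^{\rm sg}=\rho_t\llcorner\mathcal S_t,$$ where $(\mu\llcorner A)(B)=\mu(A\cap B)$. -/

import Mathlib

open MeasureTheory Filter Topology Set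
open scoped NNReal

noncomputable section

namespace Adhesion

/-- The Cole-Hopf potential
`u^ε_t(x) = -ε log ((2πεt)^{-d/2} ∫ exp (-|x-y|²/(2εt) - φ(y)/ε) dy)`,
meant for `ε > 0` and `t > 0`. -/
def viscousPotential {d : ℕ} (φ : EuclideanSpace ℝ (Fin d) → ℝ) (ε t : ℝ)
    (x : EuclideanSpace ℝ (Fin d)) : ℝ :=
  -ε * Real.log (1 / (2 * Real.pi * ε * t) ^ ((d : ℝ) / 2) *
    ∫ y : EuclideanSpace ℝ (Fin d),
      Real.exp (-(‖x - y‖ ^ 2 / (2 * ε * t)) - φ y / ε))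

/-- `X y t` is the flow of the velocity field `∇u^ε` on `[0, ∞)`: every path is continuous up to
time `0`, starts at `y`, and solves `∂_t X = ∇u^ε_t(X)` for `t > 0`. -/
structure IsViscousFlow {d : ℕ} (φ : EuclideanSpace ℝ (Fin d) → ℝ) (ε : ℝ)
    (X : EuclideanSpace ℝ (Fin d) → ℝ → EuclideanSpace ℝ (Fin d)) : Prop where
  initial : ∀ y, X y 0 = y
  continuousOn : ∀ y, ContinuousOn (X y) (Ici 0)
  hasDerivAt : ∀ y t, 0 < t →
    HasDerivAt (X y) (gradient (viscousPotential φ ε t) (X y t)) t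

/-- `X` is the zero-viscosity limit `X(y,t) = lim_{ε → 0+} X^ε(y,t)`, `t ≥ 0`, of the flows of
`∇u^ε`. -/
def IsLagrangianFlow {d : ℕ} (φ : EuclideanSpace ℝ (Fin d) → ℝ)
    (X : EuclideanSpace ℝ (Fin d) → ℝ → EuclideanSpace ℝ (Fin d)) : Prop :=
  ∃ Xε : ℝ → EuclideanSpace ℝ (Fin d) → ℝ → EuclideanSpace ℝ (Fin d),
    (∀ ε, 0 < ε → IsViscousFlow φ ε (Xε ε)) ∧
    ∀ y t, 0 ≤ t → Tendsto (fun ε => Xε ε y t) (𝓝[>] 0) (𝓝 (X y t))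

/-- The mass measure `ρ_t = (X_t)_♯ L`. -/
def massMeasure {d : ℕ} (X : EuclideanSpace ℝ (Fin d) → ℝ → EuclideanSpace ℝ (Fin d)) (t : ℝ) :
    Measure (EuclideanSpace ℝ (Fin d)) :=
  Measure.map (fun y => X y t) volume

/-- The points `y` at which `∇X_t(y)` exists and is singular. -/
def singularPoints {d : ℕ} (X : EuclideanSpace ℝ (Fin d) → ℝ → EuclideanSpace ℝ (Fin d)) (t : ℝ) :
    Set (EuclideanSpace ℝ (Fin d)) :=
  {y | DifferentiableAt ℝ (fun z => X z t) y ∧ (fderiv ℝ (fun z => X z t) y).det = 0}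

/-- The image `X_t({y : ∇X_t(y) exists and is singular})`. -/
def singularImage {d : ℕ} (X : EuclideanSpace ℝ (Fin d) → ℝ → EuclideanSpace ℝ (Fin d)) (t : ℝ) :
    Set (EuclideanSpace ℝ (Fin d)) :=
  (fun y => X y t) '' singularPoints X t

/-- `μ = μac + μsg` is the Lebesgue decomposition of `μ` with respect to `ν`. -/
structure IsLebesgueDecomposition {α : Type*} [MeasurableSpace α] (μ ν μac μsg : Measure α) :
    Prop where
  eq_add : μ = μac + μsg
  absolutelyContinuous : μac ≪ ν
  mutuallySingular : μsg ⟂ₘ ν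

end Adhesion

end

/-! The measure theory uses only that `X_t` is Lipschitz in `y`. By Rademacher, almost every `y` is
a point of differentiability. Sard's lemma makes the image `S_t` of the singular points null. On the
remaining points the derivative is invertible, so `X_t` expands small pieces by a positive factor
and pulls null sets back to null sets; hence `ρ_t` off `S_t` is absolutely continuous. `S_t` is only
analytic (a continuous image of a Borel set), so restricting to it needs universal measurability of
analytic sets, obtained from inner approximation by compact sets (`singularImage_decomposition`).

The Lipschitz bound comes from concavity. Translating the potential while keeping the Gaussian
fixed, convexity of `exp` shows that `u^ε_t` inherits `λ`-concavity, so `∇u^ε_t` is one-sided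
Lipschitz with constant `λ`. Grönwall makes the viscous flow `e^{λt}`-Lipschitz, uniformly in `ε`.

Two Laplace estimates, the upper one using `λ`-concavity and the lower one the Lipschitz bound on
`φ`, make `u^ε - u^δ` uniformly small. Adding the semiconcavity inequalities of `u^ε` and `u^δ`
turns this into a one-sided bound for `∇u^ε - ∇u^δ` with a small error, and Grönwall makes the flows
Cauchy as `ε → 0+` (`norm_flow_sub_sq_le`). No convergence of gradients is needed. -/

namespace Adhesion

/-! ### Universal measurability of analytic sets -/

section AnalyticSets

/-- Points of Baire space whose first `k` coordinates are bounded by those of `N`. -/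
def boundedCylinder (N : ℕ → ℕ) (k : ℕ) : Set (ℕ → ℕ) := {x | ∀ i < k, x i ≤ N i}

theorem boundedCylinder_congr {N M : ℕ → ℕ} {k : ℕ} (h : ∀ i < k, N i = M i) :
    boundedCylinder N k = boundedCylinder M k := by
  ext x
  exact forall₂_congr fun i hi => by rw [h i hi]

/-- The box is compact, so some thickening of it stays in the open set; truncating a point of a long
bounded cylinder at `N` gives a nearby point of the box. -/
theorem exists_boundedCylinder_subset {N : ℕ → ℕ} {V : Set (ℕ → ℕ)} (hV : IsOpen V)
    (h : (univ.pi fun i => Iic (N i)) ⊆ V) : ∃ k, boundedCylinder N k ⊆ V := by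
  let _ := PiNat.metricSpaceNatNat
  have hK : IsCompact (univ.pi fun i => Iic (N i)) :=
    isCompact_univ_pi fun i => (finite_Iic (N i)).isCompact
  obtain ⟨δ, hδ, hsub⟩ := hK.exists_thickening_subset_open hV h
  obtain ⟨k, hk⟩ := exists_pow_lt_of_lt_one hδ (by norm_num : (1 / 2 : ℝ) < 1)
  refine ⟨k, fun x hx => hsub ?_⟩
  rw [Metric.mem_thickening_iff]
  refine ⟨fun i => min (x i) (N i), fun i _ => mem_Iic.2 (min_le_right _ _), lt_of_le_of_lt ?_ hk⟩
  rw [← PiNat.mem_cylinder_iff_dist_le]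
  intro i hi
  exact (min_eq_left (hx i hi)).symm

/-- The bounds are chosen one coordinate at a time, by continuity of the outer measure along
increasing unions; the images need not be measurable. -/
theorem exists_boundedCylinder_measure_lt {α : Type*} [MeasurableSpace α] (μ : Measure α)
    (f : (ℕ → ℕ) → α) {c : ENNReal} (hc : c < μ (range f)) :
    ∃ N, ∀ k, c < μ (f '' boundedCylinder N k) := by
  have step : ∀ k N, c < μ (f '' boundedCylinder N k) →
      ∃ m, c < μ (f '' boundedCylinder (Function.update N k m) (k + 1)) := by
    intro k N hN
    have hmono : Monotone fun m => f '' boundedCylinder (Function.update N k m) (k + 1) := by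
      intro m m' hm
      refine image_mono fun x hx i hi => (hx i hi).trans ?_
      rcases eq_or_ne i k with rfl | hik
      · simpa using hm
      · simp [hik]
    have hUnion : f '' boundedCylinder N k ⊆
        ⋃ m, f '' boundedCylinder (Function.update N k m) (k + 1) := by
      rintro _ ⟨x, hx, rfl⟩
      refine mem_iUnion.2 ⟨x k, x, fun i hi => ?_, rfl⟩
      rcases eq_or_ne i k with rfl | hik
      · simp
      · simpa [hik] using hx i (by omega)
    have := hN.trans_le (measure_mono hUnion)
    rw [hmono.directed_le.measure_iUnion] at this
    exact lt_iSup_iff.1 this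
  choose! m hm using step
  -- `S n` is the bound after `n` choices. Coordinate `i` is fixed at stage `i + 1`, so the diagonal
  -- `S (i + 1) i` is the limit.
  let S : ℕ → ℕ → ℕ := fun n => Nat.rec (fun _ => 0) (fun k N => Function.update N k (m k N)) n
  have hS : ∀ k, S (k + 1) = Function.update (S k) k (m k (S k)) := fun k => rfl
  have hlt : ∀ k, c < μ (f '' boundedCylinder (S k) k) := by
    intro k
    induction k with
    | zero => simpa [boundedCylinder, image_univ] using hc
    | succ k ih => rw [hS]; exact hm k _ ih
  have hstable : ∀ i k, i < k → S k i = S (i + 1) i := by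
    intro i k hik
    induction k, hik using Nat.le_induction with
    | base => rfl
    | succ k hk ih => rw [hS, Function.update_of_ne (by omega), ih]
  refine ⟨fun i => S (i + 1) i, fun k => ?_⟩
  rw [boundedCylinder_congr (M := S k) fun i hi => (hstable i k hi).symm]
  exact hlt k

variable {α : Type*} [TopologicalSpace α] [TopologicalSpace.PseudoMetrizableSpace α]
  [MeasurableSpace α] [BorelSpace α]

/-- The compact set is the image of the box. Any open set around it contains the image of a bounded
cylinder, of measure above `c`; outer regularity concludes. -/
theorem exists_isCompact_subset_range_le_measure (μ : Measure α) [IsFiniteMeasure μ]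
    {f : (ℕ → ℕ) → α} (hf : Continuous f) {c : ENNReal} (hc : c < μ (range f)) :
    ∃ K ⊆ range f, IsCompact K ∧ c ≤ μ K := by
  obtain ⟨N, hN⟩ := exists_boundedCylinder_measure_lt μ f hc
  refine ⟨f '' univ.pi fun i => Iic (N i), image_subset_range _ _,
    (isCompact_univ_pi fun i => (finite_Iic (N i)).isCompact).image hf, ?_⟩
  rw [Set.measure_eq_iInf_isOpen]
  refine le_iInf₂ fun U hU => le_iInf fun hUo => ?_
  obtain ⟨k, hk⟩ := exists_boundedCylinder_subset (hUo.preimage hf) (image_subset_iff.1 hU)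
  exact (hN k).le.trans (measure_mono (image_subset_iff.2 hk))

/-- Analytic sets are universally measurable. -/
theorem _root_.MeasureTheory.AnalyticSet.nullMeasurableSet [T2Space α] {s : Set α}
    (hs : AnalyticSet s) (μ : Measure α) [SFinite μ] : NullMeasurableSet s μ := by
  -- Only null sets matter, so `μ` may be replaced by a finite measure dominating it.
  suffices h : NullMeasurableSet s μ.toFinite from h.mono_ac (absolutelyContinuous_toFinite μ)
  generalize hν : μ.toFinite = ν
  have : IsFiniteMeasure ν := hν ▸ inferInstance
  rw [AnalyticSet] at hs
  rcases hs with rfl | ⟨f, hf, rfl⟩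
  · exact MeasurableSet.empty.nullMeasurableSet
  rcases eq_or_ne (ν (range f)) 0 with h0 | h0
  · exact NullMeasurableSet.of_null h0
  obtain ⟨c, -, hc, hlim⟩ := exists_seq_strictMono_tendsto' (pos_iff_ne_zero.2 h0)
  choose K hKf hK hcK using fun n => exists_isCompact_subset_range_le_measure ν hf (hc n).2
  have hKm : MeasurableSet (⋃ n, K n) := MeasurableSet.iUnion fun n => (hK n).isClosed.measurableSet
  have hKs : ⋃ n, K n ⊆ range f := iUnion_subset hKf
  have hle : ν (range f) ≤ ν (⋃ n, K n) :=
    le_of_tendsto' hlim fun n => (hcK n).trans (measure_mono (subset_iUnion K n))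
  refine ⟨⋃ n, K n, hKm, ?_⟩
  exact (ae_eq_of_subset_of_measure_ge hKs hle hKm.nullMeasurableSet (measure_ne_top _ _)).symm

end AnalyticSets

/-! ### Lebesgue decomposition of the image of Lebesgue measure under a Lipschitz map -/

/-- Where `f` is close to an invertible linear `A`, it shrinks measure by at most a factor `|det A|
/ 2`, so a piece with null image is null. Countably many such pieces cover the set. -/
theorem addHaar_preimage_of_det_fderiv_ne_zero {E : Type*} [NormedAddCommGroup E]
    [NormedSpace ℝ E] [FiniteDimensional ℝ E] [MeasurableSpace E] [BorelSpace E] (μ : Measure E)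
    [μ.IsAddHaarMeasure] (f : E → E) {N : Set E} (hN : μ N = 0) :
    μ {y | DifferentiableAt ℝ f y ∧ (fderiv ℝ f y).det ≠ 0 ∧ f y ∈ N} = 0 := by
  set s := {y | DifferentiableAt ℝ f y ∧ (fderiv ℝ f y).det ≠ 0 ∧ f y ∈ N} with hs
  have key : ∀ A : E →L[ℝ] E, ∃ δ : ℝ≥0, δ ≠ 0 ∧ (A.det ≠ 0 →
      ∀ t, ApproximatesLinearOn f A t δ → μ (f '' t) = 0 → μ t = 0) := by
    intro A
    -- The partition theorem wants a radius for every `A`; singular ones never occur on the set, so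
    -- any value serves.
    by_cases hA : A.det = 0
    · exact ⟨1, one_ne_zero, fun h => (h hA).elim⟩
    have hpos : 0 < |A.det| := abs_pos.2 hA
    have h := (mul_le_addHaar_image_of_lt_det μ A (m := Real.toNNReal (|A.det| / 2))
      (by
        rw [ENNReal.ofReal, ENNReal.coe_lt_coe]
        exact (Real.toNNReal_lt_toNNReal_iff hpos).2 (by linarith))).and self_mem_nhdsWithin
    obtain ⟨δ, h1, h2⟩ := h.exists
    refine ⟨δ, (show (0 : ℝ≥0) < δ from h2).ne', fun _ t ht h0 => ?_⟩
    have h3 := h1 t f ht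
    rw [h0, nonpos_iff_eq_zero, mul_eq_zero] at h3
    refine h3.resolve_left ?_
    simpa using hA
  choose r hr hrA using key
  obtain ⟨t, A, -, -, hst, happ, hAf⟩ := exists_partition_approximatesLinearOn_of_hasFDerivWithinAt
    f s (fderiv ℝ f) (fun x hx => hx.1.hasFDerivAt.hasFDerivWithinAt) r hr
  rcases s.eq_empty_or_nonempty with h0 | hne
  · rw [h0, measure_empty]
  refine measure_mono_null (t := ⋃ n, s ∩ t n) (by rw [← inter_iUnion]; exact subset_inter le_rfl hst)
    (measure_iUnion_null fun n => ?_)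
  obtain ⟨y, hy, hAy⟩ := hAf hne n
  refine hrA (A n) (by rw [hAy]; exact hy.2.1) _ (happ n) (measure_mono_null ?_ hN)
  rintro _ ⟨x, hx, rfl⟩
  exact hx.1.2.2

/-- Uniqueness of the Lebesgue decomposition; it identifies the explicit restrictions with the
canonical parts. -/
theorem isLebesgueDecomposition_eq {α : Type*} [MeasurableSpace α] {μ ν μac μsg : Measure α}
    [SFinite μ] [SigmaFinite ν] [SFinite μac] (h : IsLebesgueDecomposition μ ν μac μsg) :
    ν.withDensity (μ.rnDeriv ν) = μac ∧ μ.singularPart ν = μsg := by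
  have hac := Measure.withDensity_rnDeriv_eq μac ν h.absolutelyContinuous
  have hadd : μ = μsg + ν.withDensity (μac.rnDeriv ν) := by
    rw [hac, add_comm]; exact h.eq_add
  have hm := Measure.measurable_rnDeriv μac ν
  exact ⟨(Measure.eq_withDensity_rnDeriv hm h.mutuallySingular hadd).symm.trans hac, 
    (Measure.eq_singularPart hm h.mutuallySingular hadd).symm⟩

theorem singularImage_decomposition {d : ℕ}
    {X : EuclideanSpace ℝ (Fin d) → ℝ → EuclideanSpace ℝ (Fin d)} {t : ℝ} {C : ℝ≥0}
    (hX : LipschitzWith C fun y => X y t) :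
    volume (singularImage X t) = 0 ∧
      IsLebesgueDecomposition (massMeasure X t) volume
        ((massMeasure X t).restrict (singularImage X t)ᶜ)
        ((massMeasure X t).restrict (singularImage X t)) := by
  set f := fun y => X y t with hf
  have hnull : volume (singularImage X t) = 0 :=
    addHaar_image_eq_zero_of_det_fderivWithin_eq_zero (f' := fderiv ℝ f) volume
      (fun x hx => hx.1.hasFDerivAt.hasFDerivWithinAt) fun x hx => hx.2
  have hmeas : MeasurableSet (singularPoints X t) :=
    (measurableSet_of_differentiableAt ℝ f).inter
      ((ContinuousLinearMap.continuous_det.measurable.comp (measurable_fderiv ℝ f))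
        (measurableSet_singleton 0))
  have : SFinite (massMeasure X t) := by unfold massMeasure; infer_instance
  have hS : NullMeasurableSet (singularImage X t) (massMeasure X t) :=
    (hmeas.analyticSet.image_of_continuous hX.continuous).nullMeasurableSet _
  refine ⟨hnull, ⟨?_, ?_, ?_⟩⟩
  · have h := Measure.restrict_inter_add_sdiff₀ (μ := massMeasure X t) univ hS
    rwa [univ_inter, ← compl_eq_univ_sdiff, Measure.restrict_univ, add_comm, eq_comm] at h
  · refine Measure.AbsolutelyContinuous.mk fun N hN hN0 => ?_
    rw [Measure.restrict_apply hN, massMeasure,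
      Measure.map_apply₀ hX.continuous.measurable.aemeasurable (hN.nullMeasurableSet.inter hS.compl)]
    -- A point of differentiability mapped outside `S_t` has nonzero Jacobian.
    refine measure_mono_null (t := {y | ¬ DifferentiableAt ℝ f y} ∪
      {y | DifferentiableAt ℝ f y ∧ (fderiv ℝ f y).det ≠ 0 ∧ f y ∈ N}) ?_
      (measure_union_null hX.ae_differentiableAt
        (addHaar_preimage_of_det_fderiv_ne_zero volume f hN0))
    rintro y ⟨hyN, hyS⟩
    by_cases hd : DifferentiableAt ℝ f y
    · exact Or.inr ⟨hd, fun h0 => hyS ⟨y, ⟨hd, h0⟩, rfl⟩, hyN⟩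
    · exact Or.inl hd
  -- Mutual singularity asks for a measurable separating set, and `S_t` need not be Borel.
  · obtain ⟨T, hT, hTm, hT0⟩ := exists_measurable_superset_of_null hnull
    refine ⟨Tᶜ, hTm.compl, ?_, by simpa using hT0⟩
    rw [Measure.restrict_apply hTm.compl, show Tᶜ ∩ singularImage X t = ∅ from
      disjoint_iff_inter_eq_empty.1 (disjoint_compl_left.mono_right hT), measure_empty]

/-! ### Integral curves of one-sided Lipschitz fields -/

section Flows

variable {E : Type*} [NormedAddCommGroup E] [InnerProductSpace ℝ E]

/-- Grönwall estimate for two curves whose velocities satisfy a one-sided Lipschitz bound up to an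
error `c`. -/
theorem norm_sub_sq_le_of_inner_le {X Y X' Y' : ℝ → E} {a b lam c : ℝ} (hab : a ≤ b)
    (hlam : 0 ≤ lam) (hc : 0 ≤ c) (hX : ContinuousOn X (Icc a b)) (hY : ContinuousOn Y (Icc a b))
    (hX' : ∀ t ∈ Ioo a b, HasDerivAt X (X' t) t) (hY' : ∀ t ∈ Ioo a b, HasDerivAt Y (Y' t) t)
    (h : ∀ t ∈ Ioo a b, inner ℝ (X' t - Y' t) (X t - Y t) ≤ lam * ‖X t - Y t‖ ^ 2 + c) :
    ‖X b - Y b‖ ^ 2 ≤ Real.exp (2 * lam * (b - a)) * (‖X a - Y a‖ ^ 2 + 2 * c * (b - a)) := by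
  -- This function is nonincreasing: the exponential absorbs the `lam` term, and since it is at most
  -- `1` the linear term absorbs the error `c`.
  set g : ℝ → ℝ := fun t =>
    Real.exp (-(2 * lam * (t - a))) * ‖X t - Y t‖ ^ 2 - 2 * c * (t - a) with hg
  have hder : ∀ t ∈ Ioo a b, HasDerivAt g
      (Real.exp (-(2 * lam * (t - a))) * (-(2 * lam * 1)) * ‖X t - Y t‖ ^ 2 +
        Real.exp (-(2 * lam * (t - a))) * (2 * inner ℝ (X t - Y t) (X' t - Y' t)) -
          2 * c * 1) t := by
    intro t ht
    have h1 : HasDerivAt (fun t : ℝ => t - a) 1 t := (hasDerivAt_id t).sub_const a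
    have h2 := ((hX' t ht).sub (hY' t ht)).norm_sq
    exact ((((h1.const_mul (2 * lam)).neg).exp).mul h2).sub (h1.const_mul (2 * c))
  have hanti : AntitoneOn g (Icc a b) := by
    refine antitoneOn_of_deriv_nonpos (convex_Icc a b) ?_ ?_ ?_
    · exact ((Continuous.continuousOn (by fun_prop)).mul ((hX.sub hY).norm.pow 2)).sub
        (Continuous.continuousOn (by fun_prop))
    · rw [interior_Icc]
      exact fun t ht => (hder t ht).differentiableAt.differentiableWithinAt
    · rw [interior_Icc]
      intro t ht
      rw [(hder t ht).deriv, real_inner_comm]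
      have h1 := h t ht
      have h2 : Real.exp (-(2 * lam * (t - a))) ≤ 1 :=
        Real.exp_le_one_iff.2 (neg_nonpos.2 (mul_nonneg (by linarith) (by linarith [ht.1])))
      have h3 := Real.exp_pos (-(2 * lam * (t - a)))
      nlinarith [mul_le_mul_of_nonneg_left h1 h3.le, mul_le_mul_of_nonneg_right h2 hc]
  have := hanti (left_mem_Icc.2 hab) (right_mem_Icc.2 hab) hab
  simp only [hg, sub_self, mul_zero, neg_zero, Real.exp_zero, one_mul, sub_zero] at this
  rw [Real.exp_neg, sub_le_iff_le_add, inv_mul_le_iff₀ (Real.exp_pos _)] at this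
  exact this

/-- The derivative is unknown at the left endpoint, so the mean value inequality is applied on `[s,
b]` and `s` tends to `a`. -/
theorem norm_sub_le_of_norm_deriv_le {X X' : ℝ → E} {a b K : ℝ} (hab : a ≤ b)
    (hX : ContinuousOn X (Icc a b)) (hX' : ∀ t ∈ Ioo a b, HasDerivAt X (X' t) t)
    (h : ∀ t ∈ Ioo a b, ‖X' t‖ ≤ K) : ‖X b - X a‖ ≤ K * (b - a) := by
  rcases hab.eq_or_lt with rfl | hlt
  · simp
  refine le_of_tendsto_of_tendsto (b := 𝓝[>] a) (f := fun s => ‖X b - X s‖)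
    (g := fun s => K * (b - s)) ?_ ?_ ?_
  · exact (tendsto_const_nhds.sub (((hX a (left_mem_Icc.2 hab)).tendsto).mono_left
      (nhdsWithin_le_of_mem (Icc_mem_nhdsGT hlt)))).norm
  · exact ((continuous_const.mul (continuous_const.sub continuous_id)).tendsto a).mono_left
      nhdsWithin_le_nhds
  · filter_upwards [Ioo_mem_nhdsGT hlt] with s hs
    exact norm_image_sub_le_of_norm_deriv_right_le_segment
      (hX.mono (Icc_subset_Icc_left hs.1.le))
      (fun t ht => (hX' t ⟨hs.1.trans_le ht.1, ht.2⟩).hasDerivWithinAt)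
      (fun t ht => h t ⟨hs.1.trans_le ht.1, ht.2⟩) b (right_mem_Icc.2 hs.2.le)

variable [CompleteSpace E]

/-- A bounded velocity field on `(0, ∞)`, locally Lipschitz in space, has integral curves on every
compact interval of positive times. -/
theorem exists_integralCurve_Icc {v : ℝ → E → E} {K : ℝ≥0}
    (hbd : ∀ t, 0 < t → ∀ x, ‖v t x‖ ≤ K)
    (hcont : ∀ x, ContinuousOn (fun t => v t x) (Ioi 0))
    (hlip : ∀ a b x₀ R, 0 < a → ∃ L : ℝ≥0, ∀ t ∈ Icc a b,
      LipschitzOnWith L (v t) (Metric.closedBall x₀ R))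
    (y : E) {a b : ℝ} (ha : 0 < a) (hab : a ≤ b) :
    ∃ X : ℝ → E, X a = y ∧ ContinuousOn X (Icc a b) ∧
      ∀ t ∈ Ioo a b, HasDerivAt X (v t (X t)) t := by
  -- A curve of speed at most `K` cannot leave this ball before time `b`, so Picard–Lindelöf covers
  -- the whole interval.
  obtain ⟨L, hL⟩ := hlip a b y (K * Real.toNNReal (b - a) : ℝ≥0) ha
  have hPL : IsPicardLindelof v (⟨a, left_mem_Icc.2 hab⟩ : Icc a b) y
      (K * Real.toNNReal (b - a)) 0 K L :=
    { lipschitzOnWith := hL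
      continuousOn := fun x _ => (hcont x).mono fun t ht => ha.trans_le ht.1
      norm_le := fun t ht x _ => hbd t (ha.trans_le ht.1) x
      mul_max_le := by simp [hab] }
  obtain ⟨X, hX0, hX⟩ := hPL.exists_eq_forall_mem_Icc_hasDerivWithinAt₀
  exact ⟨X, hX0, fun t ht => (hX t ht).continuousWithinAt, fun t ht =>
    (hX t (Ioo_subset_Icc_self ht)).hasDerivAt (Icc_mem_nhds ht.1 ht.2)⟩

/-- The spatial Lipschitz constants may blow up at time `0`, so curves are started from `y` at times
`s n → 0`. An earlier curve has moved at most `K * s n` by time `s n`, and the one-sided bound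
propagates this gap with factor `e^{lam t}`: the curves are Cauchy. -/
theorem exists_integralCurve_Ici {v : ℝ → E → E} {K : ℝ≥0} {lam : ℝ} (hlam : 0 ≤ lam)
    (hbd : ∀ t, 0 < t → ∀ x, ‖v t x‖ ≤ K)
    (hcont : ∀ x, ContinuousOn (fun t => v t x) (Ioi 0))
    (hlip : ∀ a b x₀ R, 0 < a → ∃ L : ℝ≥0, ∀ t ∈ Icc a b,
      LipschitzOnWith L (v t) (Metric.closedBall x₀ R))
    (hone : ∀ t, 0 < t → ∀ x x', inner ℝ (v t x - v t x') (x - x') ≤ lam * ‖x - x'‖ ^ 2)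
    (y : E) :
    ∃ X : ℝ → E, X 0 = y ∧ ContinuousOn X (Ici 0) ∧
      ∀ t, 0 < t → HasDerivAt X (v t (X t)) t := by
  set s : ℕ → ℝ := fun n => 1 / ((n : ℝ) + 1) with hs
  have hs0 : ∀ n, 0 < s n := fun n => Nat.one_div_pos_of_nat
  have hslim : Tendsto s atTop (𝓝 0) := tendsto_one_div_add_atTop_nhds_zero_nat
  have hsT : ∀ n : ℕ, s n ≤ n + 1 := fun n => by
    have h2 : (0 : ℝ) ≤ n := n.cast_nonneg
    have h1 : s n ≤ 1 := (div_le_one (by linarith)).2 (by linarith)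
    linarith
  have hsanti : ∀ {n m}, n ≤ m → s m ≤ s n := fun h => Nat.one_div_le_one_div h
  choose X hXs hXc hXd using fun n =>
    exists_integralCurve_Icc hbd hcont hlip y (hs0 n) (hsT n)
  have hnear : ∀ n t, s n ≤ t → t ≤ n + 1 → ‖X n t - y‖ ≤ K * (t - s n) := by
    intro n t h1 h2
    rw [← hXs n]
    exact norm_sub_le_of_norm_deriv_le h1 ((hXc n).mono (Icc_subset_Icc_right h2))
      (fun r hr => hXd n r ⟨hr.1, hr.2.trans_le h2⟩) fun r hr => hbd r ((hs0 n).trans hr.1) _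
  have hcmp : ∀ n m t, n ≤ m → s n ≤ t → t ≤ n + 1 →
      ‖X m t - X n t‖ ≤ Real.exp (lam * t) * (K * s n) := by
    intro n m t hnm h1 h2
    have hnm' : (n : ℝ) ≤ m := by exact_mod_cast hnm
    have h := norm_sub_sq_le_of_inner_le (X := X m) (Y := X n) (lam := lam) (c := 0) h1 hlam le_rfl
      ((hXc m).mono (Icc_subset_Icc (hsanti hnm) (by linarith)))
      ((hXc n).mono (Icc_subset_Icc_right h2))
      (fun r hr => hXd m r ⟨(hsanti hnm).trans_lt hr.1, by linarith [hr.2]⟩)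
      (fun r hr => hXd n r ⟨hr.1, hr.2.trans_le h2⟩)
      (fun r hr => by simpa using hone r ((hs0 n).trans hr.1) _ _)
    rw [hXs n, mul_zero, zero_mul, add_zero] at h
    have h3 := hnear m (s n) (hsanti hnm) (by linarith [hsT n])
    have h4 : ‖X m (s n) - y‖ ≤ K * s n :=
      h3.trans (mul_le_mul_of_nonneg_left (by linarith [hs0 m]) K.2)
    have hK0 : 0 ≤ K * s n := mul_nonneg K.2 (hs0 n).le
    refine abs_le_of_sq_le_sq' ?_ (by positivity) |>.2
    calc ‖X m t - X n t‖ ^ 2 ≤ _ := h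
      _ ≤ Real.exp (2 * lam * t) * (K * s n) ^ 2 := by
        gcongr
        linarith [hs0 n]
      _ = _ := by rw [mul_pow (Real.exp _), ← Real.exp_nat_mul]; congr 2; push_cast; ring
  have hev : ∀ t, 0 < t → ∀ᶠ n : ℕ in atTop, s n ≤ t ∧ t ≤ n + 1 := fun t ht =>
    (hslim.eventually (ge_mem_nhds ht)).and
      ((tendsto_natCast_atTop_atTop.eventually (eventually_ge_atTop t)).mono fun n hn => by linarith)
  have hlim : ∀ t, 0 < t → ∃ z, Tendsto (fun n => X n t) atTop (𝓝 z) := by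
    intro t ht
    refine cauchySeq_tendsto_of_complete (Metric.cauchySeq_iff'.2 fun δ hδ => ?_)
    have h0 : Tendsto (fun n => Real.exp (lam * t) * (K * s n)) atTop (𝓝 0) := by
      simpa using (hslim.const_mul (K : ℝ)).const_mul (Real.exp (lam * t))
    obtain ⟨n, hn1, hn2⟩ := ((hev t ht).and (h0.eventually (gt_mem_nhds hδ))).exists
    exact ⟨n, fun m hm => by
      rw [dist_eq_norm]; exact (hcmp n m t hm hn1.1 hn1.2).trans_lt hn2⟩
  choose! Z hZ using hlim
  have hZn : ∀ n t, s n ≤ t → t ≤ n + 1 → ‖Z t - X n t‖ ≤ Real.exp (lam * t) * (K * s n) :=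
    fun n t h1 h2 => le_of_tendsto (((hZ t ((hs0 n).trans_le h1)).sub_const _).norm)
      (eventually_atTop.2 ⟨n, fun m hm => hcmp n m t hm h1 h2⟩)
  have hZy : ∀ t, 0 < t → ‖Z t - y‖ ≤ K * t := fun t ht =>
    le_of_tendsto (((hZ t ht).sub_const _).norm) ((hev t ht).mono fun n hn =>
      (hnear n t hn.1 hn.2).trans (mul_le_mul_of_nonneg_left (by linarith [hs0 n]) K.2))
  have hZd : ∀ t, 0 < t → HasDerivAt Z (v t (Z t)) t := by
    intro t ht
    -- All the curves stay in this ball up to time `t + 1`, so the velocities converge uniformly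
    -- near `t` and the equation passes to the limit.
    obtain ⟨L, hL⟩ := hlip (t / 2) (t + 1) y (K * (t + 1)) (by linarith)
    have hevU : ∀ᶠ n : ℕ in atTop, ∀ r ∈ Ioo (t / 2) (t + 1), s n < r ∧ r < n + 1 := by
      filter_upwards [(hev (t / 2) (by linarith)), hev (t + 1) (by linarith)] with n h1 h2 r hr
      exact ⟨h1.1.trans_lt hr.1, hr.2.trans_le h2.2⟩
    refine hasDerivAt_of_tendstoUniformlyOn (f := X) (f' := fun n r => v r (X n r))
      (g' := fun r => v r (Z r)) (l := atTop) isOpen_Ioo ?_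
      (hevU.mono fun n hn r hr => hXd n r (hn r hr))
      (fun r hr => hZ r (by linarith [hr.1])) (⟨by linarith, by linarith⟩ : t ∈ Ioo (t / 2) (t + 1))
    rw [Metric.tendstoUniformlyOn_iff]
    intro δ hδ
    have h0 : Tendsto (fun n => L * (Real.exp (lam * (t + 1)) * (K * s n))) atTop (𝓝 0) := by
      simpa using ((hslim.const_mul (K : ℝ)).const_mul (Real.exp (lam * (t + 1)))).const_mul (L : ℝ)
    filter_upwards [hevU, h0.eventually (gt_mem_nhds hδ)] with n hn hlt r hr
    have hr0 : 0 < r := by linarith [hr.1]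
    refine lt_of_le_of_lt ?_ hlt
    have hKs : 0 ≤ K * s n := mul_nonneg K.2 (hs0 n).le
    refine ((hL r (Ioo_subset_Icc_self hr)).dist_le_mul _ ?_ _ ?_).trans
      (mul_le_mul_of_nonneg_left ?_ L.2)
    · rw [mem_closedBall_iff_norm]
      exact (hZy r hr0).trans (mul_le_mul_of_nonneg_left hr.2.le K.2)
    · rw [mem_closedBall_iff_norm]
      exact (hnear n r (hn r hr).1.le (hn r hr).2.le).trans
        (mul_le_mul_of_nonneg_left (by linarith [hr.2, hs0 n]) K.2)
    · rw [dist_eq_norm]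
      refine (hZn n r (hn r hr).1.le (hn r hr).2.le).trans ?_
      gcongr
      exact hr.2.le
  -- `Z` is specified only at positive times; `‖Z t - y‖ ≤ K * t` gives continuity at `0`.
  refine ⟨fun t => if t ≤ 0 then y else Z t, by simp, ?_, fun t ht => ?_⟩
  · intro t ht
    rcases (mem_Ici.1 ht).eq_or_lt with rfl | ht'
    · rw [ContinuousWithinAt, if_pos le_rfl, tendsto_iff_norm_sub_tendsto_zero]
      refine squeeze_zero' (Eventually.of_forall fun _ => norm_nonneg _)
        (g := fun t : ℝ => K * t) ?_ ?_
      · filter_upwards [self_mem_nhdsWithin] with r hr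
        rcases (mem_Ici.1 hr).eq_or_lt with rfl | hr'
        · simp
        · rw [if_neg hr'.not_ge]
          exact hZy r hr'
      · simpa using ((continuous_const.mul continuous_id).tendsto (0 : ℝ)).mono_left
          (nhdsWithin_le_nhds (s := Ici (0 : ℝ))) (f := fun t : ℝ => (K : ℝ) * t)
    · refine ((hZd t ht').continuousAt.congr ?_).continuousWithinAt
      filter_upwards [Ioi_mem_nhds ht'] with r hr
      rw [if_neg (mem_Ioi.1 hr).not_ge]
  · simp only [if_neg ht.not_ge]
    refine (hZd t ht).congr_of_eventuallyEq ?_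
    filter_upwards [Ioi_mem_nhds ht] with r hr
    rw [if_neg (mem_Ioi.1 hr).not_ge]

end Flows

/-! ### Pointwise bounds for Lipschitz and semiconcave potentials -/

section Prelim

variable {V : Type*} [NormedAddCommGroup V] {ψ : V → ℝ} {k : ℝ≥0}

theorem abs_exp_sub_exp_le {p q M : ℝ} (hp : p ≤ M) (hq : q ≤ M) :
    |Real.exp p - Real.exp q| ≤ Real.exp M * |p - q| := by
  wlog h : q ≤ p generalizing p q
  · rw [abs_sub_comm, abs_sub_comm p]
    exact this hq hp (le_of_not_ge h)
  rw [abs_of_nonneg (sub_nonneg.2 (Real.exp_le_exp.2 h)), abs_of_nonneg (sub_nonneg.2 h)]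
  have h1 : Real.exp p * (q - p + 1) ≤ Real.exp q := by
    calc _ ≤ Real.exp p * Real.exp (q - p) := by
          gcongr
          exact Real.add_one_le_exp _
      _ = _ := by rw [← Real.exp_add]; congr 1; ring
  have h2 : Real.exp p * (p - q) ≤ Real.exp M * (p - q) :=
    mul_le_mul_of_nonneg_right (Real.exp_le_exp.2 hp) (sub_nonneg.2 h)
  linarith

theorem sub_mul_norm_le_of_lipschitzWith (hψ : LipschitzWith k ψ) (x z : V) :
    ψ x - k * ‖z‖ ≤ ψ (x + z) := by
  have := (abs_le.1 (hψ.norm_sub_le (x + z) x)).1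
  rw [add_sub_cancel_left] at this
  linarith

theorem le_add_mul_norm_of_lipschitzWith (hψ : LipschitzWith k ψ) (x z : V) :
    ψ (x + z) ≤ ψ x + k * ‖z‖ := by
  have := (abs_le.1 (hψ.norm_sub_le (x + z) x)).2
  rw [add_sub_cancel_left] at this
  linarith

theorem le_of_concaveOn_sub_norm_sq [InnerProductSpace ℝ V] {mu : ℝ}
    (hconc : ConcaveOn ℝ univ fun y => ψ y - mu / 2 * ‖y‖ ^ 2) (x y : V) {a : ℝ} (ha0 : 0 ≤ a)
    (ha1 : a ≤ 1) :
    (1 - a) * ψ x + a * ψ y - mu / 2 * (a * (1 - a) * ‖y - x‖ ^ 2) ≤ ψ (x + a • (y - x)) := by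
  have h := hconc.2 (mem_univ x) (mem_univ y) (sub_nonneg.2 ha1) ha0 (by ring)
  have he : (1 - a) • x + a • y = x + a • (y - x) := by module
  rw [he] at h
  simp only [smul_eq_mul] at h
  have h1 : ‖x + a • (y - x)‖ ^ 2 =
      (1 - a) * ‖x‖ ^ 2 + a * ‖y‖ ^ 2 - a * (1 - a) * ‖y - x‖ ^ 2 := by
    rw [norm_add_sq_real, norm_smul, real_inner_smul_right, inner_sub_right, norm_sub_sq_real,
      real_inner_self_eq_norm_sq, real_inner_comm, mul_pow, norm_sub_sq_real, Real.norm_eq_abs,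
      sq_abs]
    ring
  rw [h1] at h
  linarith

theorem gibbsWeight_le (hψ : LipschitzWith k ψ) {s S : ℝ} (hs : 0 < s) (hsS : s ≤ S) (x z : V) :
    Real.exp (-(‖z‖ ^ 2 / s) - ψ (x + z)) ≤
      Real.exp (-ψ x) * Real.exp (k * ‖z‖ - S⁻¹ * ‖z‖ ^ 2) := by
  rw [← Real.exp_add, Real.exp_le_exp]
  have h1 := sub_mul_norm_le_of_lipschitzWith hψ x z
  have h2 : S⁻¹ * ‖z‖ ^ 2 ≤ ‖z‖ ^ 2 / s := by
    rw [div_eq_inv_mul]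
    gcongr
  linarith

/-- The growth condition covers both `w = 1` and `w = id`, and the bound is uniform in `s ≤ S`, as
dominated convergence requires. -/
theorem norm_gibbsWeight_smul_le {F : Type*} [NormedAddCommGroup F]
    [NormedSpace ℝ F] {w : V → F} (hψ : LipschitzWith k ψ) (hw : ∀ z, ‖w z‖ ≤ 1 + ‖z‖) {s S : ℝ}
    (hs : 0 < s) (hsS : s ≤ S) (x z : V) :
    ‖Real.exp (-(‖z‖ ^ 2 / s) - ψ (x + z)) • w z‖ ≤
      Real.exp (-ψ x) * ((1 + ‖z‖) * Real.exp (k * ‖z‖ - S⁻¹ * ‖z‖ ^ 2)) := by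
  rw [norm_smul, Real.norm_of_nonneg (Real.exp_pos _).le]
  calc _ ≤ Real.exp (-ψ x) * Real.exp (k * ‖z‖ - S⁻¹ * ‖z‖ ^ 2) * (1 + ‖z‖) := by
        gcongr
        · exact gibbsWeight_le hψ hs hsS x z
        · exact hw z
    _ = _ := by ring

end Prelim

/-! ### Gibbs integrals and log-partition functions -/

section GaussianMoments

variable {V : Type*} [NormedAddCommGroup V] [InnerProductSpace ℝ V] [FiniteDimensional ℝ V]
  [MeasurableSpace V] [BorelSpace V]

theorem integrable_exp_neg_mul_norm_sq {a : ℝ} (ha : 0 < a) :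
    Integrable fun z : V => Real.exp (-a * ‖z‖ ^ 2) := by
  refine Integrable.of_integral_ne_zero ?_
  rw [GaussianFourier.integral_rexp_neg_mul_sq_norm ha]
  exact (Real.rpow_pos_of_pos (div_pos Real.pi_pos ha) _).ne'

theorem integrable_one_add_norm_mul_exp {a : ℝ} (ha : 0 < a) (b : ℝ) :
    Integrable fun z : V => (1 + ‖z‖) * Real.exp (b * ‖z‖ - a * ‖z‖ ^ 2) := by
  -- After `1 + r ≤ e^r`, half of the Gaussian absorbs the linear exponent `(b + 1) r`; the constant
  -- comes from completing the square.
  refine ((integrable_exp_neg_mul_norm_sq (V := V) (half_pos ha)).const_mul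
    (Real.exp ((b + 1) ^ 2 / (2 * a)))).mono' (Continuous.aestronglyMeasurable (by fun_prop))
    (Eventually.of_forall fun z => ?_)
  rw [Real.norm_of_nonneg (by positivity), ← Real.exp_add]
  calc (1 + ‖z‖) * Real.exp (b * ‖z‖ - a * ‖z‖ ^ 2)
      ≤ Real.exp ‖z‖ * Real.exp (b * ‖z‖ - a * ‖z‖ ^ 2) := by
        gcongr
        linarith [Real.add_one_le_exp ‖z‖]
    _ ≤ _ := by
        rw [← Real.exp_add, Real.exp_le_exp]
        have h : (b + 1) ^ 2 / (2 * a) + -(a / 2) * ‖z‖ ^ 2 - (‖z‖ + (b * ‖z‖ - a * ‖z‖ ^ 2)) =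
            (a * ‖z‖ - (b + 1)) ^ 2 / (2 * a) := by
          field_simp
          ring
        have : 0 ≤ (a * ‖z‖ - (b + 1)) ^ 2 / (2 * a) := by positivity
        linarith

/-- The unnormalized Gibbs moment `∫ e^{-|z|²/s - ψ(x+z)} w(z) dz`. -/
noncomputable def gibbsMoment {F : Type*} [NormedAddCommGroup F] [NormedSpace ℝ F] (ψ : V → ℝ) (w : V → F)
    (s : ℝ) (x : V) : F :=
  ∫ z, Real.exp (-(‖z‖ ^ 2 / s) - ψ (x + z)) • w z

/-- The partition function `∫ e^{-|x-y|²/s - ψ(y)} dy`. -/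
noncomputable def partitionFunction (ψ : V → ℝ) (s : ℝ) (x : V) : ℝ :=
  ∫ y, Real.exp (-(‖x - y‖ ^ 2 / s) - ψ y)

theorem partitionFunction_eq_integral_add (ψ : V → ℝ) (s : ℝ) (x : V) :
    partitionFunction ψ s x = ∫ z, Real.exp (-(‖z‖ ^ 2 / s) - ψ (x + z)) := by
  rw [partitionFunction, ← integral_add_left_eq_self _ x]
  simp

theorem partitionFunction_eq_gibbsMoment (ψ : V → ℝ) (s : ℝ) (x : V) :
    partitionFunction ψ s x = gibbsMoment ψ (fun _ => (1 : ℝ)) s x := by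
  simp [partitionFunction_eq_integral_add, gibbsMoment]

variable {F : Type*} [NormedAddCommGroup F] [NormedSpace ℝ F]
  {ψ : V → ℝ} {k : ℝ≥0} {w : V → F} {s : ℝ}

theorem integrable_gibbsWeight_smul (hψ : LipschitzWith k ψ) (hwc : Continuous w)
    (hw : ∀ z, ‖w z‖ ≤ 1 + ‖z‖) (hs : 0 < s) (x : V) :
    Integrable fun z => Real.exp (-(‖z‖ ^ 2 / s) - ψ (x + z)) • w z := by
  have hc := hψ.continuous
  exact ((integrable_one_add_norm_mul_exp (inv_pos.2 hs) k).const_mul (Real.exp (-ψ x))).mono'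
    (Continuous.aestronglyMeasurable (by fun_prop))
    (Eventually.of_forall (norm_gibbsWeight_smul_le hψ hw hs le_rfl x))

theorem integrable_gibbsWeight (hψ : LipschitzWith k ψ) (hs : 0 < s) (x : V) :
    Integrable fun z => Real.exp (-(‖z‖ ^ 2 / s) - ψ (x + z)) := by
  simpa using integrable_gibbsWeight_smul (w := fun _ => (1 : ℝ)) hψ continuous_const
    (fun z => by simp) hs x

theorem partitionFunction_pos (hψ : LipschitzWith k ψ) (hs : 0 < s) (x : V) :
    0 < partitionFunction ψ s x := by
  rw [partitionFunction_eq_integral_add]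
  exact integral_exp_pos (integrable_gibbsWeight hψ hs x)

theorem norm_gibbsMoment_le (hψ : LipschitzWith k ψ) (hw : ∀ z, ‖w z‖ ≤ 1 + ‖z‖) {S : ℝ}
    (hs : 0 < s) (hsS : s ≤ S) (x : V) :
    ‖gibbsMoment ψ w s x‖ ≤
      Real.exp (-ψ x) * ∫ z : V, (1 + ‖z‖) * Real.exp (k * ‖z‖ - S⁻¹ * ‖z‖ ^ 2) := by
  rw [← integral_const_mul]
  exact norm_integral_le_of_norm_le
    ((integrable_one_add_norm_mul_exp (inv_pos.2 (hs.trans_le hsS)) k).const_mul _)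
    (Eventually.of_forall (norm_gibbsWeight_smul_le hψ hw hs hsS x))

/-- In shifted variables the Gaussian does not depend on `x`; only `ψ` varies, and it is Lipschitz.
-/
theorem norm_gibbsMoment_sub_le (hψ : LipschitzWith k ψ) (hwc : Continuous w)
    (hw : ∀ z, ‖w z‖ ≤ 1 + ‖z‖) {S M : ℝ} (hs : 0 < s) (hsS : s ≤ S) {x x' : V}
    (hx : -ψ x ≤ M) (hx' : -ψ x' ≤ M) :
    ‖gibbsMoment ψ w s x - gibbsMoment ψ w s x'‖ ≤
      (k * Real.exp M * ∫ z : V, (1 + ‖z‖) * Real.exp (k * ‖z‖ - S⁻¹ * ‖z‖ ^ 2)) * ‖x - x'‖ := by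
  rw [gibbsMoment, gibbsMoment, ← integral_sub (integrable_gibbsWeight_smul hψ hwc hw hs x)
    (integrable_gibbsWeight_smul hψ hwc hw hs x'), mul_right_comm, ← integral_const_mul]
  refine norm_integral_le_of_norm_le
    ((integrable_one_add_norm_mul_exp (inv_pos.2 (hs.trans_le hsS)) k).const_mul _)
    (Eventually.of_forall fun z => ?_)
  rw [← sub_smul, norm_smul]
  have h2 : S⁻¹ * ‖z‖ ^ 2 ≤ ‖z‖ ^ 2 / s := by
    rw [div_eq_inv_mul]
    gcongr
  have h3 := sub_mul_norm_le_of_lipschitzWith hψ x z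
  have h4 := sub_mul_norm_le_of_lipschitzWith hψ x' z
  have h5 := abs_exp_sub_exp_le (p := -(‖z‖ ^ 2 / s) - ψ (x + z))
    (q := -(‖z‖ ^ 2 / s) - ψ (x' + z)) (M := M + (k * ‖z‖ - S⁻¹ * ‖z‖ ^ 2))
    (by linarith) (by linarith)
  have h6 : |-(‖z‖ ^ 2 / s) - ψ (x + z) - (-(‖z‖ ^ 2 / s) - ψ (x' + z))| ≤ k * ‖x - x'‖ := by
    have := hψ.norm_sub_le (x' + z) (x + z)
    rw [add_sub_add_right_eq_sub, norm_sub_rev x' x, Real.norm_eq_abs] at this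
    convert this using 2
    ring
  calc _ ≤ (Real.exp (M + (k * ‖z‖ - S⁻¹ * ‖z‖ ^ 2)) * (k * ‖x - x'‖)) * (1 + ‖z‖) := by
        gcongr
        · exact h5.trans (by gcongr)
        · exact hw z
    _ = _ := by rw [Real.exp_add]; ring

theorem continuousOn_gibbsMoment (hψ : LipschitzWith k ψ) (hwc : Continuous w)
    (hw : ∀ z, ‖w z‖ ≤ 1 + ‖z‖) (x : V) :
    ContinuousOn (fun s => gibbsMoment ψ w s x) (Ioi 0) := by
  intro s hs
  have hs0 : 0 < s := hs
  have hc := hψ.continuous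
  refine ContinuousAt.continuousWithinAt (continuousAt_of_dominated
    (bound := fun z => Real.exp (-ψ x) * ((1 + ‖z‖) * Real.exp (k * ‖z‖ - (s + 1)⁻¹ * ‖z‖ ^ 2)))
    (Eventually.of_forall fun r => Continuous.aestronglyMeasurable (by fun_prop)) ?_
    ((integrable_one_add_norm_mul_exp (by positivity) k).const_mul _)
    (Eventually.of_forall fun z => ?_))
  · filter_upwards [Ioo_mem_nhds hs0 (lt_add_one s)] with r hr
    exact Eventually.of_forall (norm_gibbsWeight_smul_le hψ hw hr.1 hr.2.le x)
  · have hne := hs0.ne'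
    fun_prop (disch := assumption)

/-- Since `ψ` need not be differentiable, the unshifted integral is used, where the derivative falls
on the Gaussian; translating back gives the moment. -/
theorem hasGradientAt_partitionFunction (hψ : LipschitzWith k ψ) (hs : 0 < s) (x : V) :
    HasGradientAt (partitionFunction ψ s) ((2 / s) • gibbsMoment ψ id s x) x := by
  have hc := hψ.continuous
  have hmain : HasFDerivAt (partitionFunction ψ s) (∫ y, innerSL ℝ
      ((Real.exp (-(‖x - y‖ ^ 2 / s) - ψ y) * (-(2 / s))) • (x - y))) x := by
    refine hasFDerivAt_integral_of_dominated_of_fderiv_le (μ := volume)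
      (F := fun x y => Real.exp (-(‖x - y‖ ^ 2 / s) - ψ y))
      (F' := fun x y => innerSL ℝ
        ((Real.exp (-(‖x - y‖ ^ 2 / s) - ψ y) * (-(2 / s))) • (x - y)))
      (bound := fun y => (2 / s * Real.exp (s⁻¹ - ψ x)) *
        ((1 + ‖y - x‖) * Real.exp (k * ‖y - x‖ - (2 * s)⁻¹ * ‖y - x‖ ^ 2)))
      (Metric.ball_mem_nhds x one_pos)
      (Eventually.of_forall fun r => Continuous.aestronglyMeasurable (by fun_prop)) ?_
      (Continuous.aestronglyMeasurable (by fun_prop)) ?_ ?_ ?_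
    · have := (integrable_gibbsWeight hψ hs x).comp_sub_right x
      simpa [norm_sub_rev] using this
    · refine Eventually.of_forall fun y r hr => ?_
      rw [innerSL_apply_norm, norm_smul, norm_mul, norm_neg, Real.norm_of_nonneg (Real.exp_pos _).le,
        Real.norm_of_nonneg (by positivity : 0 ≤ 2 / s)]
      rw [mem_ball_iff_norm] at hr
      have h1 : ‖r - y‖ ≤ 1 + ‖y - x‖ := by
        have := norm_sub_le_norm_sub_add_norm_sub r x y
        rw [norm_sub_rev x y] at this
        linarith
      have h2 : ‖y - x‖ ≤ ‖r - y‖ + 1 := by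
        have := norm_sub_le_norm_sub_add_norm_sub y r x
        rw [norm_sub_rev y r] at this
        linarith
      -- Moving the centre within the unit ball costs half the Gaussian rate and a factor `e^{1/s}`,
      -- as in the chosen bound.
      have h3 : ‖y - x‖ ^ 2 ≤ 2 * ‖r - y‖ ^ 2 + 2 := by
        nlinarith [norm_nonneg (y - x), norm_nonneg (r - y), sq_nonneg (‖r - y‖ - 1)]
      have h4 := sub_mul_norm_le_of_lipschitzWith hψ x (y - x)
      rw [add_sub_cancel] at h4
      have h5 : (2 * s)⁻¹ * ‖y - x‖ ^ 2 ≤ ‖r - y‖ ^ 2 / s + s⁻¹ := by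
        have : (2 * s)⁻¹ * ‖y - x‖ ^ 2 ≤ (2 * s)⁻¹ * (2 * ‖r - y‖ ^ 2 + 2) := by gcongr
        refine this.trans_eq ?_
        field_simp
      calc _ ≤ Real.exp ((s⁻¹ - ψ x) + (k * ‖y - x‖ - (2 * s)⁻¹ * ‖y - x‖ ^ 2)) * (2 / s) *
            (1 + ‖y - x‖) := by
            gcongr
            linarith
        _ = _ := by rw [Real.exp_add]; ring
    · exact ((integrable_one_add_norm_mul_exp (by positivity) k).comp_sub_right x).const_mul _
    · refine Eventually.of_forall fun y r _ => ?_
      have h1 : HasFDerivAt (fun x : V => x - y) (ContinuousLinearMap.id ℝ V) r :=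
        (hasFDerivAt_id r).sub_const y
      have h2 : HasFDerivAt (fun x => Real.exp (-(‖x - y‖ ^ 2 / s) - ψ y)) _ r :=
        (((h1.norm_sq.mul_const s⁻¹).fun_neg).sub_const (ψ y)).exp
      refine h2.congr_fderiv ?_
      ext v
      simp [div_eq_inv_mul, mul_comm (‖r - y‖ ^ 2)]
      ring
  rw [hasGradientAt_iff_hasFDerivAt]
  refine hmain.congr_fderiv ?_
  have hint : Integrable fun y => (Real.exp (-(‖x - y‖ ^ 2 / s) - ψ y) * (-(2 / s))) • (x - y) := by
    have := ((integrable_gibbsWeight_smul (w := id) hψ continuous_id (fun z => by simp)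
      hs x).comp_sub_right x).smul (2 / s)
    refine this.congr (Eventually.of_forall fun y => ?_)
    simp only [Pi.smul_apply, id, add_sub_cancel, norm_sub_rev y x, smul_smul]
    rw [← neg_sub x y, smul_neg, ← neg_smul]
    congr 1
    ring
  rw [ContinuousLinearMap.integral_comp_comm _ hint]
  have hshift : ∫ y, (Real.exp (-(‖x - y‖ ^ 2 / s) - ψ y) * (-(2 / s))) • (x - y) =
      (2 / s) • gibbsMoment ψ id s x := by
    rw [← integral_add_left_eq_self _ x, gibbsMoment, ← integral_smul]
    refine integral_congr_ae (Eventually.of_forall fun z => ?_)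
    simp only [sub_add_cancel_left, norm_neg, smul_neg, smul_smul, id, ← neg_smul]
    congr 1
    ring
  rw [hshift]
  rfl

theorem partitionFunction_le_exp_mul (hψ : LipschitzWith k ψ) (hs : 0 < s) (x x' : V) :
    partitionFunction ψ s x ≤ Real.exp (k * ‖x - x'‖) * partitionFunction ψ s x' := by
  rw [partitionFunction_eq_integral_add, partitionFunction_eq_integral_add, ← integral_const_mul]
  refine integral_mono (integrable_gibbsWeight hψ hs x)
    ((integrable_gibbsWeight hψ hs x').const_mul _) fun z => ?_
  simp only [← Real.exp_add, Real.exp_le_exp]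
  have := (abs_le.1 (hψ.norm_sub_le (x + z) (x' + z))).1
  rw [add_sub_add_right_eq_sub] at this
  linarith

/-- The log-partition function of a `k`-Lipschitz potential is `k`-Lipschitz. -/
theorem lipschitzWith_log_partitionFunction (hψ : LipschitzWith k ψ) (hs : 0 < s) :
    LipschitzWith k fun x => Real.log (partitionFunction ψ s x) := by
  refine LipschitzWith.of_le_add_mul k fun x x' => ?_
  rw [dist_eq_norm]
  have h := Real.log_le_log (partitionFunction_pos hψ hs x) (partitionFunction_le_exp_mul hψ hs x x')
  rw [Real.log_mul (Real.exp_pos _).ne' (partitionFunction_pos hψ hs x').ne', Real.log_exp] at h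
  linarith

/-- Hölder's inequality in disguise: normalising both integrals to `1` by `e^{-A}` and `e^{-B}`
reduces it to pointwise convexity of `exp`. -/
theorem log_partitionFunction_add_smul_le (hψ : LipschitzWith k ψ) (hs : 0 < s) {mu : ℝ}
    (hconc : ConcaveOn ℝ univ fun y => ψ y - mu / 2 * ‖y‖ ^ 2) (x y : V) {a : ℝ} (ha0 : 0 ≤ a)
    (ha1 : a ≤ 1) :
    Real.log (partitionFunction ψ s (x + a • (y - x))) ≤
      (1 - a) * Real.log (partitionFunction ψ s x) + a * Real.log (partitionFunction ψ s y) +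
        mu / 2 * (a * (1 - a) * ‖y - x‖ ^ 2) := by
  set A := Real.log (partitionFunction ψ s x) with hA
  set B := Real.log (partitionFunction ψ s y) with hB
  have hexp : ∀ u, Real.exp (-Real.log (partitionFunction ψ s u)) *
      ∫ z, Real.exp (-(‖z‖ ^ 2 / s) - ψ (u + z)) = 1 := fun u => by
    rw [← partitionFunction_eq_integral_add, Real.exp_neg,
      Real.exp_log (partitionFunction_pos hψ hs u)]
    exact inv_mul_cancel₀ (partitionFunction_pos hψ hs u).ne'
  set C := (1 - a) * A + a * B + mu / 2 * (a * (1 - a) * ‖y - x‖ ^ 2) with hC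
  rw [Real.log_le_iff_le_exp (partitionFunction_pos hψ hs _), ← div_le_one (Real.exp_pos _),
    div_eq_inv_mul, ← Real.exp_neg, partitionFunction_eq_integral_add, ← integral_const_mul]
  calc ∫ z, Real.exp (-C) * Real.exp (-(‖z‖ ^ 2 / s) - ψ (x + a • (y - x) + z))
      ≤ ∫ z, ((1 - a) * (Real.exp (-A) * Real.exp (-(‖z‖ ^ 2 / s) - ψ (x + z))) +
          a * (Real.exp (-B) * Real.exp (-(‖z‖ ^ 2 / s) - ψ (y + z)))) := by
        refine integral_mono ((integrable_gibbsWeight hψ hs _).const_mul _)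
          ((((integrable_gibbsWeight hψ hs x).const_mul _).const_mul _).add
            (((integrable_gibbsWeight hψ hs y).const_mul _).const_mul _)) fun z => ?_
        simp only [← Real.exp_add]
        have h1 := convexOn_exp.2 (mem_univ (-A + (-(‖z‖ ^ 2 / s) - ψ (x + z))))
          (mem_univ (-B + (-(‖z‖ ^ 2 / s) - ψ (y + z)))) (sub_nonneg.2 ha1) ha0 (by ring)
        simp only [smul_eq_mul] at h1
        refine le_trans (Real.exp_le_exp.2 ?_) h1
        have h2 := le_of_concaveOn_sub_norm_sq hconc (x + z) (y + z) ha0 ha1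
        rw [add_sub_add_right_eq_sub, add_right_comm] at h2
        rw [hC]
        linarith
    _ = 1 := by
        rw [integral_add (((integrable_gibbsWeight hψ hs x).const_mul _).const_mul _)
            (((integrable_gibbsWeight hψ hs y).const_mul _).const_mul _),
          integral_const_mul, integral_const_mul, integral_const_mul, integral_const_mul,
          hexp x, hexp y]
        ring

end GaussianMoments

/-! ### Local Lipschitz bound for the Gibbs mean -/

section GibbsMean

variable {V : Type*} [NormedAddCommGroup V] [InnerProductSpace ℝ V] [FiniteDimensional ℝ V]
  [MeasurableSpace V] [BorelSpace V] {ψ : V → ℝ} {k : ℝ≥0} {s : ℝ}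

theorem partitionFunction_mono (hψ : LipschitzWith k ψ) {S : ℝ} (hs : 0 < s) (hsS : s ≤ S) (x : V) :
    partitionFunction ψ s x ≤ partitionFunction ψ S x := by
  rw [partitionFunction_eq_integral_add, partitionFunction_eq_integral_add]
  refine integral_mono (integrable_gibbsWeight hψ hs x)
    (integrable_gibbsWeight hψ (hs.trans_le hsS) x) fun z => ?_
  simp only [Real.exp_le_exp]
  gcongr

/-- The Gibbs mean of the displacement is Lipschitz on balls, uniformly for `s` in compact
intervals of positive reals. -/
theorem exists_lipschitzOnWith_gibbsMean (hψ : LipschitzWith k ψ) {S : ℝ} (hs : 0 < s) (x₀ : V)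
    (R : ℝ) : ∃ L : ℝ≥0, ∀ r ∈ Icc s S, LipschitzOnWith L
      (fun x => (partitionFunction ψ r x)⁻¹ • gibbsMoment ψ id r x) (Metric.closedBall x₀ R) := by
  set M := -ψ x₀ + k * R with hM
  set I := ∫ z : V, (1 + ‖z‖) * Real.exp (k * ‖z‖ - S⁻¹ * ‖z‖ ^ 2) with hI
  have hI0 : 0 ≤ I := integral_nonneg fun z => by positivity
  set h := Real.exp (-(k * R)) * partitionFunction ψ s x₀ with hh
  have hh0 : 0 < h := mul_pos (Real.exp_pos _) (partitionFunction_pos hψ hs x₀)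
  set D := k * Real.exp M * I with hD
  have hD0 : 0 ≤ D := by positivity
  -- Quotient rule: `h` bounds the partition function below, `D` is a Lipschitz constant of
  -- numerator and denominator, and `e^M * I` bounds the numerator.
  refine ⟨Real.toNNReal (h⁻¹ * D + h⁻¹ * h⁻¹ * D * (Real.exp M * I)), fun r hr =>
    LipschitzOnWith.of_dist_le_mul fun x hx x' hx' => ?_⟩
  have hr0 : 0 < r := hs.trans_le hr.1
  have hball : ∀ y ∈ Metric.closedBall x₀ R, -ψ y ≤ M ∧ h ≤ partitionFunction ψ r y := by
    intro y hy
    rw [mem_closedBall_iff_norm] at hy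
    constructor
    · have h1 := sub_mul_norm_le_of_lipschitzWith hψ x₀ (y - x₀)
      rw [add_sub_cancel] at h1
      have h2 : k * ‖y - x₀‖ ≤ k * R := by gcongr
      linarith
    · have h1 := partitionFunction_le_exp_mul hψ hr0 x₀ y
      have h2 := partitionFunction_mono hψ hs hr.1 x₀
      rw [hh, Real.exp_neg, inv_mul_le_iff₀ (Real.exp_pos _)]
      refine h2.trans (h1.trans (mul_le_mul_of_nonneg_right ?_ (partitionFunction_pos hψ hr0 y).le))
      rw [Real.exp_le_exp, norm_sub_rev]
      gcongr
  obtain ⟨hxM, hxh⟩ := hball x hx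
  obtain ⟨hxM', hxh'⟩ := hball x' hx'
  have hid : ∀ z : V, ‖id z‖ ≤ 1 + ‖z‖ := fun z => by simp
  have h1 := norm_gibbsMoment_sub_le (w := id) hψ continuous_id hid hr0 hr.2 hxM hxM'
  have h2 := norm_gibbsMoment_sub_le (w := fun _ => (1 : ℝ)) hψ continuous_const
    (fun z => by simp) hr0 hr.2 hxM' hxM
  have h3 := norm_gibbsMoment_le (w := id) hψ hid hr0 hr.2 x'
  rw [← partitionFunction_eq_gibbsMoment, ← partitionFunction_eq_gibbsMoment, norm_sub_rev x' x] at h2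
  set A := gibbsMoment ψ id r x
  set A' := gibbsMoment ψ id r x'
  set Z := partitionFunction ψ r x
  set Z' := partitionFunction ψ r x'
  have hZ : 0 < Z := hh0.trans_le hxh
  have hZ' : 0 < Z' := hh0.trans_le hxh'
  have hA' : ‖A'‖ ≤ Real.exp M * I := h3.trans (by gcongr)
  have hsplit : Z⁻¹ • A - Z'⁻¹ • A' = Z⁻¹ • (A - A') + (Z⁻¹ * Z'⁻¹ * (Z' - Z)) • A' := by
    have : Z'⁻¹ = Z⁻¹ - Z⁻¹ * Z'⁻¹ * (Z' - Z) := by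
      field_simp
      ring
    nth_rewrite 1 [this]
    rw [smul_sub, sub_smul]
    abel
  rw [dist_eq_norm, dist_eq_norm, hsplit, Real.coe_toNNReal _ (by positivity)]
  refine (norm_add_le _ _).trans ?_
  rw [norm_smul, norm_smul, norm_mul, norm_mul, Real.norm_of_nonneg (inv_pos.2 hZ).le,
    Real.norm_of_nonneg (inv_pos.2 hZ').le]
  calc _ ≤ h⁻¹ * (D * ‖x - x'‖) + h⁻¹ * h⁻¹ * (D * ‖x - x'‖) * (Real.exp M * I) := by gcongr
    _ = _ := by ring

end GibbsMean

/-! ### Regularity of the Cole-Hopf potential and the viscous flow -/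

section ViscousPotential

variable {d : ℕ} {φ : EuclideanSpace ℝ (Fin d) → ℝ} {K : ℝ≥0} {lam ε t : ℝ}

theorem lipschitzWith_div_const (hK : LipschitzWith K φ) (hε : 0 < ε) :
    LipschitzWith (K / ε.toNNReal) fun y => φ y / ε := by
  refine LipschitzWith.of_dist_le_mul fun x y => ?_
  rw [Real.dist_eq, ← sub_div, abs_div, abs_of_pos hε, NNReal.coe_div, Real.coe_toNNReal _ hε.le,
    div_mul_eq_mul_div, ← Real.dist_eq]
  exact div_le_div_of_nonneg_right (hK.dist_le_mul x y) hε.le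

theorem concaveOn_div_const (hconc : ConcaveOn ℝ univ fun y => φ y - lam / 2 * ‖y‖ ^ 2)
    (hε : 0 < ε) : ConcaveOn ℝ univ fun y => φ y / ε - lam / ε / 2 * ‖y‖ ^ 2 := by
  refine (hconc.smul (inv_pos.2 hε).le).congr fun z _ => ?_
  simp only [smul_eq_mul]
  ring

theorem viscousPotential_eq (hK : LipschitzWith K φ) (hε : 0 < ε) (ht : 0 < t)
    (x : EuclideanSpace ℝ (Fin d)) :
    viscousPotential φ ε t x = ε * (d / 2 * Real.log (2 * Real.pi * ε * t)) -
      ε * Real.log (partitionFunction (fun y => φ y / ε) (2 * ε * t) x) := by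
  have hZ := partitionFunction_pos (lipschitzWith_div_const hK hε) (by positivity : 0 < 2 * ε * t) x
  have hpos : 0 < 2 * Real.pi * ε * t := by have := Real.pi_pos; positivity
  change -ε * Real.log (1 / (2 * Real.pi * ε * t) ^ ((d : ℝ) / 2) *
    partitionFunction (fun y => φ y / ε) (2 * ε * t) x) = _
  rw [Real.log_mul (by positivity) hZ.ne', one_div, Real.log_inv, Real.log_rpow hpos]
  ring

/-- Chain rule with `s = 2εt`: the velocity is minus the Gibbs mean displacement divided by `t`. -/
theorem hasGradientAt_viscousPotential (hK : LipschitzWith K φ) (hε : 0 < ε) (ht : 0 < t)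
    (x : EuclideanSpace ℝ (Fin d)) :
    HasGradientAt (viscousPotential φ ε t) (-t⁻¹ •
      ((partitionFunction (fun y => φ y / ε) (2 * ε * t) x)⁻¹ •
        gibbsMoment (fun y => φ y / ε) id (2 * ε * t) x)) x := by
  have hψ := lipschitzWith_div_const hK hε
  have hs : 0 < 2 * ε * t := by positivity
  have h1 := hasGradientAt_partitionFunction hψ hs x
  rw [hasGradientAt_iff_hasFDerivAt] at h1 ⊢
  have h2 := ((h1.log (partitionFunction_pos hψ hs x).ne').const_mul ε).const_sub
    (ε * (d / 2 * Real.log (2 * Real.pi * ε * t)))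
  rw [show viscousPotential φ ε t = _ from funext fun x => viscousPotential_eq hK hε ht x]
  refine h2.congr_fderiv ?_
  ext v
  simp
  field_simp

theorem lipschitzWith_viscousPotential (hK : LipschitzWith K φ) (hε : 0 < ε) (ht : 0 < t) :
    LipschitzWith K (viscousPotential φ ε t) := by
  have h := lipschitzWith_log_partitionFunction (lipschitzWith_div_const hK hε)
    (by positivity : 0 < 2 * ε * t)
  refine LipschitzWith.of_dist_le_mul fun x y => ?_
  have h1 := h.dist_le_mul x y
  rw [Real.dist_eq, NNReal.coe_div, Real.coe_toNNReal _ hε.le, div_mul_eq_mul_div,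
    le_div_iff₀ hε] at h1
  rw [viscousPotential_eq hK hε ht, viscousPotential_eq hK hε ht, Real.dist_eq, sub_sub_sub_cancel_left,
    ← mul_sub, abs_mul, abs_of_pos hε, mul_comm ε, abs_sub_comm]
  exact h1

theorem norm_gradient_viscousPotential_le (hK : LipschitzWith K φ) (hε : 0 < ε) (ht : 0 < t)
    (x : EuclideanSpace ℝ (Fin d)) : ‖gradient (viscousPotential φ ε t) x‖ ≤ K := by
  rw [gradient, LinearIsometryEquiv.norm_map]
  exact norm_fderiv_le_of_lipschitz ℝ (lipschitzWith_viscousPotential hK hε ht)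

/-- `λ`-concavity of `φ` is inherited by the Cole-Hopf potential. -/
theorem viscousPotential_le_add_inner (hK : LipschitzWith K φ)
    (hconc : ConcaveOn ℝ univ fun y => φ y - lam / 2 * ‖y‖ ^ 2) (hε : 0 < ε) (ht : 0 < t)
    (x y : EuclideanSpace ℝ (Fin d)) :
    viscousPotential φ ε t y ≤ viscousPotential φ ε t x +
      inner ℝ (gradient (viscousPotential φ ε t) x) (y - x) + lam / 2 * ‖y - x‖ ^ 2 := by
  have hψ := lipschitzWith_div_const hK hε
  have hs : 0 < 2 * ε * t := by positivity
  have hψc := concaveOn_div_const hconc hε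
  set u := viscousPotential φ ε t with hu
  -- Semiconcavity along the segment bounds the secant slope below; `a → 0+` yields the gradient
  -- inequality.
  have hineq : ∀ a ∈ Ioo (0 : ℝ) 1, u y - u x - lam / 2 * ((1 - a) * ‖y - x‖ ^ 2) ≤
      a⁻¹ • (u (x + a • (y - x)) - u x) := by
    intro a ha
    have h1 := log_partitionFunction_add_smul_le hψ hs hψc x y ha.1.le ha.2.le
    rw [smul_eq_mul, le_inv_mul_iff₀ ha.1]
    simp only [hu, viscousPotential_eq hK hε ht]
    have h2 := mul_le_mul_of_nonneg_left h1 hε.le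
    have h3 : ε * (lam / ε / 2 * (a * (1 - a) * ‖y - x‖ ^ 2)) =
        lam / 2 * (a * (1 - a) * ‖y - x‖ ^ 2) := by field_simp
    rw [mul_add, h3] at h2
    linarith
  have hdiff : HasFDerivAt u (fderiv ℝ u x) x :=
    (hasGradientAt_viscousPotential hK hε ht x).differentiableAt.hasFDerivAt
  have hlim := (hdiff.hasLineDerivAt (y - x)).tendsto_slope_zero_right
  have hlim2 : Tendsto (fun a : ℝ => u y - u x - lam / 2 * ((1 - a) * ‖y - x‖ ^ 2)) (𝓝[>] 0)
      (𝓝 (u y - u x - lam / 2 * ((1 - 0) * ‖y - x‖ ^ 2))) :=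
    (Continuous.tendsto (by fun_prop) _).mono_left nhdsWithin_le_nhds
  have hle := le_of_tendsto_of_tendsto hlim2 hlim (by
    filter_upwards [Ioo_mem_nhdsGT one_pos] with a ha
    simpa using hineq a ha)
  rw [inner_gradient_left]
  linarith

/-- Add the semiconcavity inequalities of `u^ε` at `x` and `u^δ` at `y`; the leftover differences of
potentials, one at each point, cost `2η`. -/
theorem inner_gradient_sub_gradient_le {η : ℝ} {δ : ℝ} (hK : LipschitzWith K φ)
    (hconc : ConcaveOn ℝ univ fun y => φ y - lam / 2 * ‖y‖ ^ 2) (hε : 0 < ε) (hδ : 0 < δ)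
    (ht : 0 < t) (h : ∀ x, |viscousPotential φ ε t x - viscousPotential φ δ t x| ≤ η)
    (x y : EuclideanSpace ℝ (Fin d)) :
    inner ℝ (gradient (viscousPotential φ ε t) x - gradient (viscousPotential φ δ t) y) (x - y) ≤
      lam * ‖x - y‖ ^ 2 + 2 * η := by
  have h1 := viscousPotential_le_add_inner hK hconc hε ht x y
  have h2 := viscousPotential_le_add_inner hK hconc hδ ht y x
  rw [← neg_sub x y, inner_neg_right, norm_neg] at h1
  rw [inner_sub_left]
  have h3 := abs_le.1 (h x)
  have h4 := abs_le.1 (h y)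
  linarith [h3.2, h4.1]

theorem inner_gradient_viscousPotential_sub_le (hK : LipschitzWith K φ)
    (hconc : ConcaveOn ℝ univ fun y => φ y - lam / 2 * ‖y‖ ^ 2) (hε : 0 < ε) (ht : 0 < t)
    (x y : EuclideanSpace ℝ (Fin d)) :
    inner ℝ (gradient (viscousPotential φ ε t) x - gradient (viscousPotential φ ε t) y) (x - y) ≤
      lam * ‖x - y‖ ^ 2 := by
  simpa using inner_gradient_sub_gradient_le (η := 0) hK hconc hε hε ht (by simp) x y

theorem exists_isViscousFlow (hK : LipschitzWith K φ) (hlam : 0 ≤ lam)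
    (hconc : ConcaveOn ℝ univ fun y => φ y - lam / 2 * ‖y‖ ^ 2) (hε : 0 < ε) :
    ∃ X, IsViscousFlow φ ε X := by
  have hψ := lipschitzWith_div_const hK hε
  have hgrad : ∀ t, 0 < t → ∀ x, gradient (viscousPotential φ ε t) x = -t⁻¹ •
      ((partitionFunction (fun y => φ y / ε) (2 * ε * t) x)⁻¹ •
        gibbsMoment (fun y => φ y / ε) id (2 * ε * t) x) :=
    fun t ht x => (hasGradientAt_viscousPotential hK hε ht x).gradient
  have hcont : ∀ x, ContinuousOn (fun t => gradient (viscousPotential φ ε t) x) (Ioi 0) := by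
    intro x
    refine ContinuousOn.congr ?_ fun t ht => hgrad t ht x
    have hmaps : MapsTo (fun t : ℝ => 2 * ε * t) (Ioi 0) (Ioi 0) := fun t ht => by
      have : 0 < t := ht
      exact mem_Ioi.2 (by positivity)
    have h1 := (continuousOn_gibbsMoment (w := id) hψ continuous_id (fun z => by simp) x).comp
      (Continuous.continuousOn (by fun_prop)) hmaps
    have h2 := (continuousOn_gibbsMoment (w := fun _ => (1 : ℝ)) hψ continuous_const
      (fun z => by simp) x).comp (Continuous.continuousOn (by fun_prop)) hmaps
    simp only [partitionFunction_eq_gibbsMoment]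
    refine ContinuousOn.smul (continuousOn_id.inv₀ fun t ht => (mem_Ioi.1 ht).ne').neg
      ((h2.inv₀ fun t ht => ?_).smul h1)
    simp only [Function.comp, ← partitionFunction_eq_gibbsMoment]
    exact (partitionFunction_pos hψ (hmaps ht) x).ne'
  have hlip : ∀ a b x₀ R, 0 < a → ∃ L : ℝ≥0, ∀ t ∈ Icc a b,
      LipschitzOnWith L (gradient (viscousPotential φ ε t)) (Metric.closedBall x₀ R) := by
    intro a b x₀ R ha
    obtain ⟨L, hL⟩ := exists_lipschitzOnWith_gibbsMean (S := 2 * ε * b) hψ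
      (by positivity : 0 < 2 * ε * a) x₀ R
    refine ⟨Real.toNNReal a⁻¹ * L, fun t ht => LipschitzOnWith.of_dist_le_mul fun x hx y hy => ?_⟩
    have ht0 : 0 < t := ha.trans_le ht.1
    have h1 := (hL (2 * ε * t) ⟨by gcongr; exact ht.1, by gcongr; exact ht.2⟩).dist_le_mul x hx y hy
    rw [hgrad t ht0, hgrad t ht0, dist_smul₀, norm_neg, Real.norm_of_nonneg (inv_pos.2 ht0).le,
      NNReal.coe_mul, Real.coe_toNNReal _ (inv_pos.2 ha).le, mul_assoc a⁻¹]
    exact mul_le_mul (inv_anti₀ ha ht.1) h1 dist_nonneg (inv_pos.2 ha).le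
  choose X h0 hc hd using exists_integralCurve_Ici hlam
    (fun t ht x => norm_gradient_viscousPotential_le hK hε ht x) hcont hlip
    (fun t ht x y => inner_gradient_viscousPotential_sub_le hK hconc hε ht x y)
  exact ⟨X, h0, hc, hd⟩

theorem IsViscousFlow.lipschitzWith (hK : LipschitzWith K φ) (hlam : 0 ≤ lam)
    (hconc : ConcaveOn ℝ univ fun y => φ y - lam / 2 * ‖y‖ ^ 2) (hε : 0 < ε)
    {X : EuclideanSpace ℝ (Fin d) → ℝ → EuclideanSpace ℝ (Fin d)} (hX : IsViscousFlow φ ε X)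
    (ht : 0 ≤ t) : LipschitzWith (Real.toNNReal (Real.exp (lam * t))) fun y => X y t := by
  refine LipschitzWith.of_dist_le_mul fun y z => ?_
  rw [Real.coe_toNNReal _ (Real.exp_pos _).le, dist_eq_norm, dist_eq_norm]
  have h := norm_sub_sq_le_of_inner_le (X := X y) (Y := X z) (c := 0) ht hlam le_rfl
    ((hX.continuousOn y).mono Icc_subset_Ici_self) ((hX.continuousOn z).mono Icc_subset_Ici_self)
    (fun r hr => hX.hasDerivAt y r hr.1) (fun r hr => hX.hasDerivAt z r hr.1)
    (fun r hr => by
      simpa using inner_gradient_viscousPotential_sub_le hK hconc hε hr.1 (X y r) (X z r))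
  rw [hX.initial, hX.initial] at h
  refine (abs_le_of_sq_le_sq' (h.trans_eq ?_) (by positivity)).2
  rw [mul_pow, ← Real.exp_nat_mul]
  push_cast
  ring_nf

end ViscousPotential

/-! ### Laplace estimates -/

section VanishingViscosity

variable {V : Type*} [NormedAddCommGroup V] [InnerProductSpace ℝ V] [FiniteDimensional ℝ V]
  [MeasurableSpace V] [BorelSpace V] {ψ : V → ℝ} {k : ℝ≥0} {s : ℝ}

theorem log_integral_exp_neg_mul_norm_sq {a : ℝ} (ha : 0 < a) :
    Real.log (∫ z : V, Real.exp (-a * ‖z‖ ^ 2)) =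
      Module.finrank ℝ V / 2 * Real.log (Real.pi / a) := by
  rw [GaussianFourier.integral_rexp_neg_mul_sq_norm ha,
    Real.log_rpow (div_pos Real.pi_pos ha)]

/-- Laplace lower bound for the partition function, by symmetrization around an arbitrary point. -/
theorem le_log_partitionFunction (hψ : LipschitzWith k ψ) (hs : 0 < s) {mu : ℝ} (hmu : 0 ≤ mu)
    (hconc : ConcaveOn ℝ univ fun y => ψ y - mu / 2 * ‖y‖ ^ 2) (x y : V) :
    -(‖x - y‖ ^ 2 / s) - ψ y + Module.finrank ℝ V / 2 * Real.log (Real.pi / (s⁻¹ + mu / 2)) ≤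
      Real.log (partitionFunction ψ s x) := by
  have ha : 0 < s⁻¹ + mu / 2 := by positivity
  have hI := integrable_exp_neg_mul_norm_sq (V := V) ha
  have hIpos : 0 < ∫ z : V, Real.exp (-(s⁻¹ + mu / 2) * ‖z‖ ^ 2) := integral_exp_pos hI
  set f : V → ℝ := fun z => Real.exp (-(‖x - (y + z)‖ ^ 2 / s) - ψ (y + z)) with hf
  have hfint : Integrable f := by
    have := (integrable_gibbsWeight hψ hs x).comp_sub_right (x - y)
    refine this.congr (Eventually.of_forall fun z => ?_)
    simp only [hf]
    rw [show z - (x - y) = -(x - (y + z)) by abel, norm_neg, show x + -(x - (y + z)) = y + z by abel]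
  have hfeq : ∫ z, f z = partitionFunction ψ s x :=
    integral_add_left_eq_self (fun u => Real.exp (-(‖x - u‖ ^ 2 / s) - ψ u)) y
  rw [← log_integral_exp_neg_mul_norm_sq ha, Real.le_log_iff_exp_le (partitionFunction_pos hψ hs x),
    Real.exp_add, Real.exp_log hIpos, ← integral_const_mul]
  -- Averaging over `z` and `-z` cancels the linear terms, and midpoint semiconcavity gives `ψ(y+z)
  -- + ψ(y-z) ≤ 2ψ(y) + mu|z|²`.
  calc ∫ z : V, Real.exp (-(‖x - y‖ ^ 2 / s) - ψ y) * Real.exp (-(s⁻¹ + mu / 2) * ‖z‖ ^ 2)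
      ≤ ∫ z, (1 / 2 * f z + 1 / 2 * f (-z)) := by
        refine integral_mono (hI.const_mul _)
          ((hfint.const_mul _).add (hfint.comp_neg.const_mul _)) fun z => ?_
        simp only [hf, ← Real.exp_add]
        have h1 := convexOn_exp.2 (mem_univ (-(‖x - (y + z)‖ ^ 2 / s) - ψ (y + z)))
          (mem_univ (-(‖x - (y + -z)‖ ^ 2 / s) - ψ (y + -z)))
          (by norm_num : (0 : ℝ) ≤ 1 / 2) (by norm_num : (0 : ℝ) ≤ 1 / 2) (by norm_num)
        simp only [smul_eq_mul] at h1
        refine le_trans (Real.exp_le_exp.2 ?_) h1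
        have h2 := le_of_concaveOn_sub_norm_sq hconc (y + z) (y + -z)
          (by norm_num : (0 : ℝ) ≤ 1 / 2) (by norm_num)
        rw [show y + z + (1 / 2 : ℝ) • (y + -z - (y + z)) = y by module,
          show y + -z - (y + z) = (-2 : ℝ) • z by module, norm_smul] at h2
        have h3 : ‖x - (y + z)‖ ^ 2 + ‖x - (y + -z)‖ ^ 2 = 2 * (‖x - y‖ ^ 2 + ‖z‖ ^ 2) := by
          rw [show x - (y + z) = x - y - z by abel, show x - (y + -z) = x - y + z by abel,
            norm_sub_sq_real, norm_add_sq_real]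
          ring
        have h4 : ‖x - (y + z)‖ ^ 2 / s + ‖x - (y + -z)‖ ^ 2 / s =
            2 * (‖x - y‖ ^ 2 / s + s⁻¹ * ‖z‖ ^ 2) := by
          rw [← add_div, h3]
          ring
        norm_num at h2
        linarith
    _ = partitionFunction ψ s x := by
        rw [integral_add (hfint.const_mul _) (hfint.comp_neg.const_mul _), integral_const_mul,
          integral_const_mul, integral_neg_eq_self, hfeq]
        ring

/-- Laplace upper bound for the partition function. -/
theorem log_partitionFunction_le (hψ : LipschitzWith k ψ) (hs : 0 < s) {θ c : ℝ} (hθ : 0 < θ)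
    (x : V) (hc : ∀ y, c ≤ (1 - θ) * (‖x - y‖ ^ 2 / s) + ψ y) :
    Real.log (partitionFunction ψ s x) ≤
      -c + Module.finrank ℝ V / 2 * Real.log (Real.pi / (θ / s)) := by
  have ha : 0 < θ / s := by positivity
  have hI := integrable_exp_neg_mul_norm_sq (V := V) ha
  have hIpos : 0 < ∫ z : V, Real.exp (-(θ / s) * ‖z‖ ^ 2) := integral_exp_pos hI
  rw [← log_integral_exp_neg_mul_norm_sq ha, Real.log_le_iff_le_exp (partitionFunction_pos hψ hs x),
    Real.exp_add, Real.exp_log hIpos, ← integral_const_mul, partitionFunction_eq_integral_add]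
  refine integral_mono (integrable_gibbsWeight hψ hs x) (hI.const_mul _) fun z => ?_
  simp only [← Real.exp_add, Real.exp_le_exp]
  have h := hc (x + z)
  rw [sub_add_cancel_left, norm_neg] at h
  have : -(θ / s) * ‖z‖ ^ 2 = -(θ * (‖z‖ ^ 2 / s)) := by ring
  rw [this]
  linarith

end VanishingViscosity

/-! ### Convergence of the viscous flows -/

section Limit

variable {d : ℕ} {φ : EuclideanSpace ℝ (Fin d) → ℝ} {K : ℝ≥0} {lam ε δ t : ℝ}

theorem viscousPotential_le (hK : LipschitzWith K φ) (hlam : 0 ≤ lam)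
    (hconc : ConcaveOn ℝ univ fun y => φ y - lam / 2 * ‖y‖ ^ 2) (hε : 0 < ε) (ht : 0 < t)
    (x y : EuclideanSpace ℝ (Fin d)) :
    viscousPotential φ ε t x ≤
      ‖x - y‖ ^ 2 / (2 * t) + φ y + ε * (d / 2 * Real.log (1 + lam * t)) := by
  have hs : 0 < 2 * ε * t := by positivity
  have h := le_log_partitionFunction (lipschitzWith_div_const hK hε) hs
    (mu := lam / ε) (by positivity) (concaveOn_div_const hconc hε) x y
  rw [viscousPotential_eq hK hε ht]
  have h1 := mul_le_mul_of_nonneg_left h hε.le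
  have hpi := Real.pi_pos
  have h2 : Real.log (Real.pi / ((2 * ε * t)⁻¹ + lam / ε / 2)) =
      Real.log (2 * Real.pi * ε * t) - Real.log (1 + lam * t) := by
    rw [← Real.log_div (by positivity) (by positivity)]
    congr 1
    field_simp
  have h3 : ε * (‖x - y‖ ^ 2 / (2 * ε * t) + φ y / ε) = ‖x - y‖ ^ 2 / (2 * t) + φ y := by
    field_simp
  rw [h2, finrank_euclideanSpace_fin] at h1
  linarith

/-- The Laplace upper bound with `θ = ε`: this share of the quadratic cost is kept for
integrability, and the Lipschitz bound on `φ` compensates for its loss. -/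
theorem le_viscousPotential (hK : LipschitzWith K φ) (hε : 0 < ε) (hε' : ε ≤ 1 / 2) (ht : 0 < t)
    (x : EuclideanSpace ℝ (Fin d)) {c : ℝ} (hc : ∀ y, c ≤ ‖x - y‖ ^ 2 / (2 * t) + φ y) :
    c - ε * (K ^ 2 * t) + ε * (d / 2 * Real.log ε) ≤ viscousPotential φ ε t x := by
  have hs : 0 < 2 * ε * t := by positivity
  have hpi := Real.pi_pos
  have key : ∀ y, (c - ε * (K ^ 2 * t)) / ε ≤
      (1 - ε) * (‖x - y‖ ^ 2 / (2 * ε * t)) + φ y / ε := by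
    intro y
    -- Testing at a point pulled slightly towards `x` lowers the quadratic cost and changes `φ` by
    -- at most `K * ε * ‖y - x‖`.
    have h1 := hc (x + (1 - ε) • (y - x))
    have h2 := le_add_mul_norm_of_lipschitzWith hK y ((-ε) • (y - x))
    rw [show y + (-ε) • (y - x) = x + (1 - ε) • (y - x) by module, norm_smul, Real.norm_eq_abs,
      abs_neg, abs_of_pos hε] at h2
    rw [sub_add_cancel_left, norm_neg, norm_smul, mul_pow, Real.norm_eq_abs, sq_abs] at h1
    rw [norm_sub_rev x y]
    set r := ‖y - x‖
    have h3 : (1 - ε) * (r ^ 2 / (2 * ε * t)) + φ y / ε =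
        ((1 - ε) * (r ^ 2 / (2 * t)) + φ y) / ε := by field_simp
    rw [h3]
    refine div_le_div_of_nonneg_right ?_ hε.le
    -- Completing the square leaves the error `ε * K² * t`; it uses `1 - ε ≥ 1 / 2`.
    have h4 : 0 ≤ ε * ((r / 2 - K * t) ^ 2 / t) := by positivity
    have h5 : ε * ((r / 2 - K * t) ^ 2 / t) =
        ε * (1 / 2) * (r ^ 2 / (2 * t)) - K * (ε * r) + ε * (K ^ 2 * t) := by
      field_simp
      ring
    have h6 : ε * (1 / 2) * (r ^ 2 / (2 * t)) ≤ ε * (1 - ε) * (r ^ 2 / (2 * t)) := by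
      gcongr
      linarith
    have h7 : (1 - ε) ^ 2 * r ^ 2 / (2 * t) =
        (1 - ε) * (r ^ 2 / (2 * t)) - ε * (1 - ε) * (r ^ 2 / (2 * t)) := by ring
    linarith
  have h := log_partitionFunction_le (lipschitzWith_div_const hK hε) hs hε x key
  rw [viscousPotential_eq hK hε ht]
  have h1 := mul_le_mul_of_nonneg_left h hε.le
  have h2 : Real.log (Real.pi / (ε / (2 * ε * t))) =
      Real.log (2 * Real.pi * ε * t) - Real.log ε := by
    rw [← Real.log_div (by positivity) (by positivity)]
    congr 1
    field_simp
  rw [h2, finrank_euclideanSpace_fin, mul_add, mul_neg, mul_div_cancel₀ _ hε.ne'] at h1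
  linarith

/-- Bound for the distance of `u^ε` to its vanishing-viscosity limit up to time `T`. -/
noncomputable def viscosityError (d : ℕ) (K lam T ε : ℝ) : ℝ :=
  ε * (d / 2 * Real.log (1 + lam * T)) + ε * (K ^ 2 * T) - d / 2 * (Real.log ε * ε)

theorem tendsto_viscosityError (d : ℕ) (K lam T : ℝ) :
    Tendsto (viscosityError d K lam T) (𝓝[>] 0) (𝓝 0) := by
  have h1 : Tendsto (fun ε : ℝ => ε) (𝓝[>] 0) (𝓝 0) := nhdsWithin_le_nhds
  have h2 : Tendsto (fun ε : ℝ => Real.log ε * ε) (𝓝[>] 0) (𝓝 0) := by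
    simpa only [Real.rpow_one] using tendsto_log_mul_rpow_nhdsGT_zero one_pos
  have h3 := ((h1.mul_const (d / 2 * Real.log (1 + lam * T))).add
    (h1.mul_const (K ^ 2 * T))).sub (h2.const_mul ((d : ℝ) / 2))
  simp only [zero_mul, mul_zero, add_zero, sub_zero] at h3
  exact h3

theorem abs_viscousPotential_sub_le (hK : LipschitzWith K φ) (hlam : 0 ≤ lam)
    (hconc : ConcaveOn ℝ univ fun y => φ y - lam / 2 * ‖y‖ ^ 2) (hε : 0 < ε) (hε' : ε ≤ 1 / 2)
    (hδ : 0 < δ) (hδ' : δ ≤ 1 / 2) (ht : 0 < t) {T : ℝ} (htT : t ≤ T)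
    (x : EuclideanSpace ℝ (Fin d)) :
    |viscousPotential φ ε t x - viscousPotential φ δ t x| ≤
      viscosityError d K lam T ε + viscosityError d K lam T δ := by
  have key : ∀ ε δ : ℝ, 0 < ε → ε ≤ 1 / 2 → 0 < δ → δ ≤ 1 / 2 →
      viscousPotential φ ε t x - viscousPotential φ δ t x ≤
        viscosityError d K lam T ε + viscosityError d K lam T δ := by
    intro ε δ hε hε' hδ hδ'
    -- The upper bound on `u^ε` holds for every `y`, so `u^ε` minus its error is an admissible `c`
    -- for `u^δ`; the Hopf–Lax infimum itself is not needed.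
    have h1 := le_viscousPotential hK hδ hδ' ht x
      (c := viscousPotential φ ε t x - ε * (d / 2 * Real.log (1 + lam * t)))
      fun y => by linarith [viscousPotential_le hK hlam hconc hε ht x y]
    have hlog : 0 ≤ Real.log (1 + lam * t) := Real.log_nonneg (by nlinarith)
    have hlogT : Real.log (1 + lam * t) ≤ Real.log (1 + lam * T) :=
      Real.log_le_log (by positivity) (by gcongr)
    have h2 : ε * (d / 2 * Real.log (1 + lam * t)) ≤ ε * (d / 2 * Real.log (1 + lam * T)) := by
      gcongr
    have h3 : δ * (K ^ 2 * t) ≤ δ * (K ^ 2 * T) := by gcongr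
    have h4 : 0 ≤ ε * (K ^ 2 * T) :=
      mul_nonneg hε.le (mul_nonneg (sq_nonneg _) (ht.le.trans htT))
    have h5 : 0 ≤ δ * (d / 2 * Real.log (1 + lam * T)) := by
      have := hlog.trans hlogT
      positivity
    have h6 : 0 ≤ d / 2 * (-Real.log ε * ε) := by
      have : 0 ≤ -Real.log ε := by linarith [Real.log_nonpos hε.le (by linarith)]
      positivity
    simp only [viscosityError]
    linarith
  exact abs_le.2 ⟨by linarith [key δ ε hδ hδ' hε hε'], key ε δ hε hε' hδ hδ'⟩

theorem norm_flow_sub_sq_le (hK : LipschitzWith K φ) (hlam : 0 ≤ lam)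
    (hconc : ConcaveOn ℝ univ fun y => φ y - lam / 2 * ‖y‖ ^ 2) (hε : 0 < ε) (hε' : ε ≤ 1 / 2)
    (hδ : 0 < δ) (hδ' : δ ≤ 1 / 2) (ht : 0 ≤ t)
    {X Y : EuclideanSpace ℝ (Fin d) → ℝ → EuclideanSpace ℝ (Fin d)} (hX : IsViscousFlow φ ε X)
    (hY : IsViscousFlow φ δ Y) (y : EuclideanSpace ℝ (Fin d)) :
    ‖X y t - Y y t‖ ^ 2 ≤ Real.exp (2 * lam * t) *
      (4 * (viscosityError d K lam t ε + viscosityError d K lam t δ) * t) := by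
  rcases ht.eq_or_lt with rfl | ht0
  · simp [hX.initial, hY.initial]
  have hu := fun r (hr : r ∈ Ioo 0 t) x =>
    abs_viscousPotential_sub_le hK hlam hconc hε hε' hδ hδ' hr.1 hr.2.le x
  have hη : 0 ≤ viscosityError d K lam t ε + viscosityError d K lam t δ :=
    (abs_nonneg _).trans (hu (t / 2) ⟨by linarith, by linarith⟩ 0)
  have h := norm_sub_sq_le_of_inner_le (X := X y) (Y := Y y) ht hlam (mul_nonneg zero_le_two hη)
    ((hX.continuousOn y).mono Icc_subset_Ici_self) ((hY.continuousOn y).mono Icc_subset_Ici_self)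
    (fun r hr => hX.hasDerivAt y r hr.1) (fun r hr => hY.hasDerivAt y r hr.1)
    (fun r hr => inner_gradient_sub_gradient_le hK hconc hε hδ hr.1 (hu r hr) _ _)
  rw [hX.initial, hY.initial] at h
  refine h.trans_eq ?_
  rw [sub_self, norm_zero, sub_zero]
  ring

theorem exists_isLagrangianFlow (hK : LipschitzWith K φ) (hlam : 0 ≤ lam)
    (hconc : ConcaveOn ℝ univ fun y => φ y - lam / 2 * ‖y‖ ^ 2) :
    ∃ X, IsLagrangianFlow φ X := by
  choose! Xε hXε using fun ε (hε : 0 < ε) => exists_isViscousFlow hK hlam hconc hε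
  suffices h : ∀ y t, 0 ≤ t → ∃ z, Tendsto (fun ε => Xε ε y t) (𝓝[>] 0) (𝓝 z) by
    choose! X hX using h
    exact ⟨X, Xε, hXε, hX⟩
  intro y t ht
  refine cauchy_map_iff_exists_tendsto.1 (Metric.cauchy_iff.2 ⟨inferInstance, fun r hr => ?_⟩)
  have hlim : Tendsto (fun ε => Real.exp (2 * lam * t) *
      (4 * (2 * viscosityError d K lam t ε) * t)) (𝓝[>] 0) (𝓝 0) := by
    simpa using ((((tendsto_viscosityError d K lam t).const_mul 2).const_mul 4).mul_const t).const_mul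
      (Real.exp (2 * lam * t))
  -- The factor `2` makes the bound for a pair `ε`, `δ` the average of the two individual
  -- quantities.
  have hev : ∀ᶠ ε in 𝓝[>] (0 : ℝ), Real.exp (2 * lam * t) *
      (4 * (2 * viscosityError d K lam t ε) * t) < r ^ 2 ∧ ε ∈ Ioo (0 : ℝ) (1 / 2) :=
    (hlim.eventually (gt_mem_nhds (by positivity))).and (Ioo_mem_nhdsGT (by norm_num))
  refine ⟨_, image_mem_map hev, ?_⟩
  rintro _ ⟨ε, ⟨h1, hε⟩, rfl⟩ _ ⟨δ, ⟨h2, hδ⟩, rfl⟩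
  have h := norm_flow_sub_sq_le hK hlam hconc hε.1 hε.2.le hδ.1 hδ.2.le ht (hXε ε hε.1)
    (hXε δ hδ.1) y
  rw [dist_eq_norm]
  refine lt_of_pow_lt_pow_left₀ 2 hr.le ?_
  linarith

theorem IsLagrangianFlow.lipschitzWith (hK : LipschitzWith K φ) (hlam : 0 ≤ lam)
    (hconc : ConcaveOn ℝ univ fun y => φ y - lam / 2 * ‖y‖ ^ 2)
    {X : EuclideanSpace ℝ (Fin d) → ℝ → EuclideanSpace ℝ (Fin d)} (hX : IsLagrangianFlow φ X)
    (ht : 0 ≤ t) : LipschitzWith (Real.toNNReal (Real.exp (lam * t))) fun y => X y t := by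
  obtain ⟨Xε, hXε, hlim⟩ := hX
  refine LipschitzWith.of_dist_le_mul fun y z => ?_
  refine le_of_tendsto ((hlim y t ht).dist (hlim z t ht)) ?_
  filter_upwards [self_mem_nhdsWithin] with ε hε
  exact ((hXε ε hε).lipschitzWith hK hlam hconc hε ht).dist_le_mul y z

end Limit

end Adhesion

theorem theorem3 {d : ℕ} (φ : EuclideanSpace ℝ (Fin d) → ℝ) (K : ℝ≥0) (lam : ℝ)
    (hK : LipschitzWith K φ) (hlam : 0 ≤ lam)
    (hconc : ConcaveOn ℝ Set.univ (fun y => φ y - lam / 2 * ‖y‖ ^ 2)) :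
    (∃ X, Adhesion.IsLagrangianFlow φ X) ∧
    ∀ X, Adhesion.IsLagrangianFlow φ X → ∀ t : ℝ, 0 ≤ t →
      volume (Adhesion.singularImage X t) = 0 ∧
      Adhesion.IsLebesgueDecomposition (Adhesion.massMeasure X t) volume
        ((Adhesion.massMeasure X t).restrict (Adhesion.singularImage X t)ᶜ)
        ((Adhesion.massMeasure X t).restrict (Adhesion.singularImage X t)) ∧
      volume.withDensity ((Adhesion.massMeasure X t).rnDeriv volume) =
        (Adhesion.massMeasure X t).restrict (Adhesion.singularImage X t)ᶜ ∧
      (Adhesion.massMeasure X t).singularPart volume =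
        (Adhesion.massMeasure X t).restrict (Adhesion.singularImage X t) := by
  refine ⟨Adhesion.exists_isLagrangianFlow hK hlam hconc, fun X hX t ht => ?_⟩
  obtain ⟨hnull, hdec⟩ :=
    Adhesion.singularImage_decomposition (hX.lipschitzWith hK hlam hconc ht)
  have : SFinite (Adhesion.massMeasure X t) := by unfold Adhesion.massMeasure; infer_instance
  exact ⟨hnull, hdec, Adhesion.isLebesgueDecomposition_eq hdec⟩
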